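/- **Setting.** Let $n,p_x\ge 1$. Node $i\in\{1,\dots,n\}$ holds $g_i:\mathbb R^{p_x}\to\mathbb R$, $h_i:\mathbb R^{p_y}\to\mathbb R$ and $P_i\in\mathbb R^{p_y\times p_x}$. Put $f_i(x,y)=g_i(x)+\langle y,P_ix\rangle-h_i(y)$, $F=\frac1n\sum_i f_i$, $G=\frac1n\sum_i g_i$, $H=\frac1n\sum_i h_i$, $\overline P=\frac1n\sum_i P_i$. Problem $\mathbf P$ is $\min_x\max_y F(x,y)$; a saddle point is a pair $(x^*,y^*)$ with $F(x^*,y)\le F(x^*,y^*)\le F(x,y^*)$ for all $x,y$. Let $W=(w_{ir})\in\mathbb R^{n\times n}$ be a weight matrix and $\lambda:=\|W-\frac1n\mathbf 1\mathbf 1^\top\|_2$ (spectral norm). **Algorithm (GT-GDA).** Given stepsizes $\alpha,\beta>0$ and arbitrary $x_i^0,y_i^0$, set $P_i^0=P_i$. With $\nabla_x f_i^k:=\nabla g_i(x_i^k)+(P_i^k)^\top y_i^k$ and $\nabla_y f_i^k:=P_i^kx_i^k-\nabla h_i(y_i^k)$, set $q_i^0=\nabla_xf_i^0$, $w_i^0=\nabla_yf_i^0$,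 and for $k=0,1,\dots$ $$P_i^{k+1}=\sum_r w_{ir}P_r^k,\quad x_i^{k+1}=\sum_r w_{ir}(x_r^k-\alpha q_r^k),\quad y_i^{k+1}=\sum_r w_{ir}(y_r^k+\beta w_r^k),$$ $$q_i^{k+1}=\sum_r w_{ir}(q_r^k+\nabla_xf_r^{k+1}-\nabla_xf_r^k),\quad w_i^{k+1}=\sum_r w_{ir}(w_r^k+\nabla_yf_r^{k+1}-\nabla_yf_r^k).$$ Each node computes two partial gradients at initialization and two in each iteration. The iterate $k$ is $\epsilon$-optimal if $\big(\sum_i\|x_i^k-x^*\|^2\big)^{1/2}+\big(\sum_i\|y_i^k-y^*\|^2\big)^{1/2}\le\epsilon$. **Assumptions.** Every $g_i$ is differentiable with $L_1$-Lipschitz gradient and every $h_i$ is differentiable with $L_2$-Lipschitz gradient ($L_1,L_2>0$); $G$ is convex; $H$ is $\mu$-strongly convex ($\mu>0$); $\overline P$ has full column rank; $W$ is primitive and doubly stochastic, and $\lambda<1$. Put $L=\max\{L_1,L_2\}$, $\kappa=L/\mu$, let $\sigma_M$ and $\sigma_m$ be the largest and the smallest singular value of $\overline P$, and $\gamma=\sigma_M/\sigma_m$.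 Let $$R:=\max\Big\{\frac{\gamma^6\kappa^3}{(1-\lambda)^4},\ \frac{\sigma_m^2\sigma_M^2\kappa}{L^2\mu^2(1-\lambda)^4},\ \gamma^2\kappa^5\Big\}.$$ **Theorem.** There are a universal constant $C>0$ and a threshold $c_0=c_0(L,\mu,\sigma_m,\sigma_M,\lambda)$ such that the following holds for every problem as above, every $c>0$ with $c\ge c_0$, and the stepsizes $$\beta=\overline\beta:=\min\Big\{\frac{\sigma_m^2(1-\lambda)^2}{192\,\sigma_M^2L},\ \frac{L(1-\lambda)^2}{48\,\sigma_M^2},\ \frac1{382\,\kappa L}\Big\},\qquad \alpha=\overline\alpha:=\overline\beta\,\frac{\mu^2}{c\,\sigma_M^2}.$$ Problem $\mathbf P$ has exactly one saddle point $(x^*,y^*)$, and: 1. There is $\rho\in[0,1)$ with $\rho\le 1-\frac{1}{C\,c\,R}$ such that, for all initial points, there is $\psi$ with $\big(\sum_i\|x_i^k-x^*\|^2\big)^{1/2}+\big(\sum_i\|y_i^k-y^*\|^2\big)^{1/2}\le\psi\rho^k$ for all $k$. 2. For all initial points there is $\epsilon_0>0$ such that, for every $0<\epsilon\le\epsilon_0$,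 after at most $C\,c\,R\,\log(1/\epsilon)$ partial-gradient computations at each node the iterate is $\epsilon$-optimal, and so are all later iterates. That is, GT-GDA reaches an $\epsilon$-optimal solution in $\mathcal O(R\log(1/\epsilon))$ gradient computations per node, the constant being $C\,c$. -/

import Mathlib

namespace GTGDA

/-- The Euclidean space `ℝᵖ`. -/
abbrev Vec (p : ℕ) : Type := EuclideanSpace ℝ (Fin p)

/-- `f` is differentiable and its gradient is `L`-Lipschitz. -/
def IsSmooth {p : ℕ} (L : ℝ) (f : Vec p → ℝ) : Prop :=
  Differentiable ℝ f ∧ ∀ u v : Vec p, ‖gradient f u - gradient f v‖ ≤ L * ‖u - v‖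

/-- `f` is differentiable and `f v + ⟨∇f v, u - v⟩ + (m / 2) ‖u - v‖² ≤ f u` for all `u`, `v`. -/
def IsStronglyConvex {p : ℕ} (m : ℝ) (f : Vec p → ℝ) : Prop :=
  Differentiable ℝ f ∧
    ∀ u v : Vec p, f v + inner ℝ (gradient f v) (u - v) + m / 2 * ‖u - v‖ ^ 2 ≤ f u

/-- The function `(x, y) ↦ g x + ⟨y, P x⟩ - h y`. -/
noncomputable def cost {px py : ℕ} (g : Vec px → ℝ) (h : Vec py → ℝ)
    (P : Matrix (Fin py) (Fin px) ℝ) (x : Vec px) (y : Vec py) : ℝ :=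
  g x + inner ℝ y (Matrix.toEuclideanLin P x) - h y

/-- The partial gradient of `cost g h P` with respect to `x`. -/
noncomputable def gradX {px py : ℕ} (g : Vec px → ℝ) (h : Vec py → ℝ)
    (P : Matrix (Fin py) (Fin px) ℝ) (x : Vec px) (y : Vec py) : Vec px :=
  gradient (fun x' => cost g h P x' y) x

/-- The partial gradient of `cost g h P` with respect to `y`. -/
noncomputable def gradY {px py : ℕ} (g : Vec px → ℝ) (h : Vec py → ℝ)
    (P : Matrix (Fin py) (Fin px) ℝ) (x : Vec px) (y : Vec py) : Vec py :=
  gradient (fun y' => cost g h P x y') y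

/-- The data of the distributed saddle point problem: node `i` holds `g i`, `h i` and `P i`. -/
structure Problem (n px py : ℕ) where
  /-- the local functions of the minimization variable -/
  g : Fin n → Vec px → ℝ
  /-- the local functions of the maximization variable -/
  h : Fin n → Vec py → ℝ
  /-- the local coupling matrices -/
  P : Fin n → Matrix (Fin py) (Fin px) ℝ

namespace Problem

variable {n px py : ℕ} (D : Problem n px py)

/-- `G = (1/n) ∑ gᵢ`. -/
noncomputable def G (x : Vec px) : ℝ := (1 / (n : ℝ)) * ∑ i, D.g i x

/-- `H = (1/n) ∑ hᵢ`. -/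
noncomputable def H (y : Vec py) : ℝ := (1 / (n : ℝ)) * ∑ i, D.h i y

/-- The global coupling matrix `P̄ = (1/n) ∑ Pᵢ`. -/
noncomputable def Pbar : Matrix (Fin py) (Fin px) ℝ := (1 / (n : ℝ)) • ∑ i, D.P i

/-- The global objective `F = (1/n) ∑ fᵢ`, with `fᵢ (x, y) = gᵢ x + ⟨y, Pᵢ x⟩ - hᵢ y`. -/
noncomputable def F (x : Vec px) (y : Vec py) : ℝ :=
  (1 / (n : ℝ)) * ∑ i, cost (D.g i) (D.h i) (D.P i) x y

/-- The largest singular value of `P̄`. -/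
noncomputable def sigmaMax : ℝ := (Matrix.toEuclideanLin D.Pbar).singularValues 0

/-- The smallest of the `px` singular values of `P̄` (listed in decreasing order from index 0). -/
noncomputable def sigmaMin : ℝ := (Matrix.toEuclideanLin D.Pbar).singularValues (px - 1)

/-- The saddle points of `F` over the whole space:
`F (a, y) ≤ F (a, b) ≤ F (x, b)` for all `x` and `y`. -/
def IsSaddle (a : Vec px) (b : Vec py) : Prop :=
  (∀ y, D.F a y ≤ D.F a b) ∧ (∀ x, D.F a b ≤ D.F x b)

end Problem

/-- `W^∞ = (1/n) 1 1ᵀ`. -/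
noncomputable def Winf (n : ℕ) : Matrix (Fin n) (Fin n) ℝ := fun _ _ => 1 / (n : ℝ)

/-- `λ = ‖W - W^∞‖`, in the spectral norm (the operator norm for the Euclidean norm). -/
noncomputable def lam {n : ℕ} (W : Matrix (Fin n) (Fin n) ℝ) : ℝ :=
  ‖Matrix.toEuclideanCLM (𝕜 := ℝ) (W - Winf n)‖

/-- What the nodes store after an iteration. The component at `i` belongs to node `i`. -/
structure State (n px py : ℕ) where
  /-- current estimates of the global coupling matrix -/
  P : Fin n → Matrix (Fin py) (Fin px) ℝ
  /-- descent iterates -/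
  x : Fin n → Vec px
  /-- ascent iterates -/
  y : Fin n → Vec py
  /-- partial gradients in `x` of the local costs at the current iterates -/
  gx : Fin n → Vec px
  /-- partial gradients in `y` of the local costs at the current iterates -/
  gy : Fin n → Vec py
  /-- gradient trackers for the descent -/
  q : Fin n → Vec px
  /-- gradient trackers for the ascent -/
  w : Fin n → Vec py
  /-- number of partial gradients computed so far -/
  evals : Fin n → ℕ

/-- Initialization: the trackers start from the local gradients at the initial points. -/
noncomputable def start {n px py : ℕ} (D : Problem n px py) (x0 : Fin n → Vec px)
    (y0 : Fin n → Vec py) : State n px py :=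
  let gx := fun i => gradX (D.g i) (D.h i) (D.P i) (x0 i) (y0 i)
  let gy := fun i => gradY (D.g i) (D.h i) (D.P i) (x0 i) (y0 i)
  { P := D.P, x := x0, y := y0, gx := gx, gy := gy, q := gx, w := gy, evals := fun _ => 2 }

/-- One iteration: consensus on the coupling matrices, descent in `x`, ascent in `y`, one new
partial gradient in `x` and one in `y` at every node (at the new iterates, with the new coupling
matrices), and the update of both trackers. -/
noncomputable def step {n px py : ℕ} (D : Problem n px py) (W : Matrix (Fin n) (Fin n) ℝ)
    (α β : ℝ) (s : State n px py) : State n px py :=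
  let P := fun i => ∑ r, W i r • s.P r
  let x := fun i => ∑ r, W i r • (s.x r - α • s.q r)
  let y := fun i => ∑ r, W i r • (s.y r + β • s.w r)
  let gx := fun i => gradX (D.g i) (D.h i) (P i) (x i) (y i)
  let gy := fun i => gradY (D.g i) (D.h i) (P i) (x i) (y i)
  { P := P
    x := x
    y := y
    gx := gx
    gy := gy
    q := fun i => ∑ r, W i r • (s.q r + gx r - s.gx r)
    w := fun i => ∑ r, W i r • (s.w r + gy r - s.gy r)
    evals := fun i => s.evals i + 2 }

/-- The state after `k` iterations of GT-GDA. -/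
noncomputable def run {n px py : ℕ} (D : Problem n px py) (W : Matrix (Fin n) (Fin n) ℝ)
    (α β : ℝ) (x0 : Fin n → Vec px) (y0 : Fin n → Vec py) (k : ℕ) : State n px py :=
  (step D W α β)^[k] (start D x0 y0)

/-- `‖x - 1 ⊗ a‖ + ‖y - 1 ⊗ b‖` for the stacked iterates `x`, `y`, in the Euclidean norm. -/
noncomputable def err {n px py : ℕ} (s : State n px py) (a : Vec px) (b : Vec py) : ℝ :=
  √(∑ i, ‖s.x i - a‖ ^ 2) + √(∑ i, ‖s.y i - b‖ ^ 2)

/-- The stepsize `β̄`, with `κ = L / μ`. -/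
noncomputable def betaBar (L μ σm σM l : ℝ) : ℝ :=
  min (min (σm ^ 2 * (1 - l) ^ 2 / (192 * σM ^ 2 * L)) (L * (1 - l) ^ 2 / (48 * σM ^ 2)))
    (1 / (382 * (L / μ) * L))

/-- The stepsize `ᾱ = β̄ μ² / (c σ_M²)`. -/
noncomputable def alphaBar (c L μ σm σM l : ℝ) : ℝ :=
  betaBar L μ σm σM l * (μ ^ 2 / (c * σM ^ 2))

/-- The maximum `max {γ⁶ κ³ / (1-λ)⁴, σ_m² σ_M² κ / (L² μ² (1-λ)⁴), γ² κ⁵}`,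
with `κ = L / μ` and `γ = σ_M / σ_m`. -/
noncomputable def rate (L μ σm σM l : ℝ) : ℝ :=
  max (max ((σM / σm) ^ 6 * (L / μ) ^ 3 / (1 - l) ^ 4)
      (σm ^ 2 * σM ^ 2 * (L / μ) / (L ^ 2 * μ ^ 2 * (1 - l) ^ 4)))
    ((σM / σm) ^ 2 * (L / μ) ^ 5)

end GTGDA

/-!
# Linear convergence of GT-GDA

Eliminating `y` turns the saddle point problem into the minimization of the primal function
`x ↦ max_y F (x, y)`. Its gradient `Φ x = ∇G x + P̄ᵀ (∇H)⁻¹ (P̄ x)` (`gradPrimal`) is Lipschitz, with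
constant `ℓ = L + σ_M² / μ`, and strongly monotone, with modulus `m = σ_m² μ / L²`, because
`(∇H)⁻¹` is strongly monotone and `P̄` is bounded below. Banach's fixed point theorem then
provides `(∇H)⁻¹` and the unique zero of `Φ`, and the saddle points are exactly the zeros of `Φ`
paired with their best responses (`isSaddle_iff`).

The iteration is followed through six error components: `√n ‖x̄ - x*‖`,
`√n ‖ȳ - (∇H)⁻¹ (P̄ x̄)‖` and the consensus errors of `x`, `y` and of the two trackers. Since the trackers keep the
averages of the local gradients, `x̄` and `ȳ` perform inexact gradient steps, which are
contractions of margin `α m / 2` and `β μ / 2` (`norm_forward_sub_le`), while mixing contracts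
each consensus error by the factor `λ` (`dev_mix_le`). The coupling matrices `Pᵢᵏ` differ from
`P̄` by `O (λᵏ)`, which makes their heterogeneity a geometrically vanishing perturbation that
costs no rate (`exists_le_mul_pow`).

What remains is a linear recursion in the six components. For `c` large, `α` is tiny compared
with `β = β̄`: to zeroth order in `α` the recursion is gradient tracking for the ascent in `y`,
for which `β̄` is admissible, and all terms of order `α` are absorbed (`exists_weights`). A
weighted sum of the components thus contracts by `1 - α m / 4` (`lyapunov_le`), and `α m / 4` is
at least `1 / (1528 c R)` (`one_le_rate_mul_margin`). Both claims follow from this margin.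
-/

namespace GTGDA

open Finset

/-! ### Stacked vectors -/

section Stack

variable {n : ℕ} {E : Type*} [NormedAddCommGroup E]

/-- The Euclidean norm of the stacked vector `(u 1, …, u n)`. -/
noncomputable def stackNorm (u : Fin n → E) : ℝ := √(∑ i, ‖u i‖ ^ 2)

lemma stackNorm_eq_norm (u : Fin n → E) :
    stackNorm u = ‖(WithLp.toLp 2 u : PiLp 2 fun _ : Fin n => E)‖ := by
  rw [PiLp.norm_eq_of_L2]; rfl

lemma stackNorm_nonneg (u : Fin n → E) : 0 ≤ stackNorm u := Real.sqrt_nonneg _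

lemma stackNorm_sq (u : Fin n → E) : stackNorm u ^ 2 = ∑ i, ‖u i‖ ^ 2 :=
  Real.sq_sqrt (by positivity)

lemma stackNorm_add_le (u v : Fin n → E) :
    stackNorm (fun i => u i + v i) ≤ stackNorm u + stackNorm v := by
  simp only [stackNorm_eq_norm]
  exact norm_add_le (WithLp.toLp 2 u : PiLp 2 fun _ : Fin n => E) (WithLp.toLp 2 v)

lemma stackNorm_sub_le (u v : Fin n → E) :
    stackNorm (fun i => u i - v i) ≤ stackNorm u + stackNorm v := by
  simp only [stackNorm_eq_norm]
  exact norm_sub_le (WithLp.toLp 2 u : PiLp 2 fun _ : Fin n => E) (WithLp.toLp 2 v)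

lemma stackNorm_const (a : E) : stackNorm (fun _ : Fin n => a) = √n * ‖a‖ := by
  simp [stackNorm]

lemma stackNorm_le_of_le {F : Type*} [NormedAddCommGroup F]
    {u : Fin n → E} {v : Fin n → F} {C : ℝ} (hC : 0 ≤ C)
    (h : ∀ i, ‖u i‖ ≤ C * ‖v i‖) : stackNorm u ≤ C * stackNorm v := by
  unfold stackNorm
  rw [← Real.sqrt_sq hC, ← Real.sqrt_mul (sq_nonneg C), mul_sum]
  refine Real.sqrt_le_sqrt (sum_le_sum fun i _ => ?_)
  rw [← mul_pow]
  exact pow_le_pow_left₀ (norm_nonneg _) (h i) 2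

variable [InnerProductSpace ℝ E]

/-- The average of the components of a stacked vector. -/
noncomputable def mean (u : Fin n → E) : E := (1 / (n : ℝ)) • ∑ i, u i

/-- The consensus error `‖u - 1 ⊗ mean u‖` of a stacked vector. -/
noncomputable def dev (u : Fin n → E) : ℝ := stackNorm fun i => u i - mean u

lemma dev_nonneg (u : Fin n → E) : 0 ≤ dev u := stackNorm_nonneg _

lemma stackNorm_smul (c : ℝ) (u : Fin n → E) :
    stackNorm (fun i => c • u i) = |c| * stackNorm u := by
  simp only [stackNorm_eq_norm]
  exact norm_smul c (WithLp.toLp 2 u : PiLp 2 fun _ : Fin n => E)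

lemma mean_add (u v : Fin n → E) : mean (fun i => u i + v i) = mean u + mean v := by
  simp [mean, sum_add_distrib]

lemma mean_sub (u v : Fin n → E) : mean (fun i => u i - v i) = mean u - mean v := by
  simp [mean, sum_sub_distrib, smul_sub]

lemma mean_smul (c : ℝ) (u : Fin n → E) : mean (fun i => c • u i) = c • mean u := by
  simp only [mean, ← smul_sum]
  exact smul_comm _ _ _

lemma sum_eq_smul_mean (hn : 0 < n) (u : Fin n → E) : ∑ i, u i = (n : ℝ) • mean u := by
  have : (n : ℝ) ≠ 0 := by positivity
  simp [mean, smul_smul, this]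

/-- Bias-variance decomposition of a stacked vector. -/
lemma stackNorm_sq_eq_dev_sq_add (hn : 0 < n) (u : Fin n → E) :
    stackNorm u ^ 2 = dev u ^ 2 + (√n * ‖mean u‖) ^ 2 := by
  have h (i : Fin n) : ‖u i - mean u‖ ^ 2 =
      ‖u i‖ ^ 2 - 2 * inner ℝ (u i) (mean u) + ‖mean u‖ ^ 2 := norm_sub_sq_real _ _
  rw [dev, stackNorm_sq, stackNorm_sq, mul_pow, Real.sq_sqrt (Nat.cast_nonneg n)]
  simp only [h, sum_add_distrib, sum_sub_distrib, ← mul_sum, ← sum_inner]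
  rw [sum_eq_smul_mean hn u, inner_smul_left, real_inner_self_eq_norm_sq]
  simp
  ring

lemma dev_le_stackNorm (hn : 0 < n) (u : Fin n → E) : dev u ≤ stackNorm u := by
  refine (sq_le_sq₀ (dev_nonneg u) (stackNorm_nonneg u)).mp ?_
  rw [stackNorm_sq_eq_dev_sq_add hn u]
  nlinarith [sq_nonneg (√n * ‖mean u‖)]

lemma sqrt_mul_norm_mean_le (hn : 0 < n) (u : Fin n → E) : √n * ‖mean u‖ ≤ stackNorm u := by
  refine (sq_le_sq₀ (by positivity) (stackNorm_nonneg u)).mp ?_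
  rw [stackNorm_sq_eq_dev_sq_add hn u]
  nlinarith [sq_nonneg (dev u)]

lemma stackNorm_sub_const_le (u : Fin n → E) (a : E) :
    stackNorm (fun i => u i - a) ≤ dev u + √n * ‖mean u - a‖ := by
  rw [← stackNorm_const]
  refine le_trans (le_of_eq ?_) (stackNorm_add_le _ _)
  congr 1; funext i; abel

lemma dev_add_le (u v : Fin n → E) : dev (fun i => u i + v i) ≤ dev u + dev v := by
  refine le_trans (le_of_eq ?_) (stackNorm_add_le _ _)
  rw [dev, mean_add]
  congr 1; funext i; abel

lemma dev_smul (c : ℝ) (u : Fin n → E) : dev (fun i => c • u i) = |c| * dev u := by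
  rw [dev, dev, mean_smul, ← stackNorm_smul]
  congr 1; funext i; rw [smul_sub]

lemma dev_sub_smul_le {c : ℝ} (hc : 0 ≤ c) (u v : Fin n → E) :
    dev (fun i => u i - c • v i) ≤ dev u + c * dev v := by
  have h := dev_add_le u fun i => (-c) • v i
  rw [dev_smul, abs_neg, abs_of_nonneg hc] at h
  simpa [sub_eq_add_neg] using h

end Stack

/-! ### Mixing with a doubly stochastic matrix -/

section Mix

variable {n : ℕ} {M : Type*} [AddCommGroup M] [Module ℝ M]

/-- One round of averaging with the neighbours: `(W ⊗ I) u`. -/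
noncomputable def mix (W : Matrix (Fin n) (Fin n) ℝ) (u : Fin n → M) : Fin n → M :=
  fun i => ∑ r, W i r • u r

lemma mix_mix (V W : Matrix (Fin n) (Fin n) ℝ) (u : Fin n → M) :
    mix V (mix W u) = mix (V * W) u := by
  funext i
  simp only [mix, Matrix.mul_apply, smul_sum, sum_smul, smul_smul]
  exact sum_comm

lemma mix_one (u : Fin n → M) : mix (1 : Matrix (Fin n) (Fin n) ℝ) u = u := by
  funext i
  simp [mix, Matrix.one_apply]

lemma sum_mix {W : Matrix (Fin n) (Fin n) ℝ} (hW : W ∈ doublyStochastic ℝ (Fin n))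
    (u : Fin n → M) : ∑ i, mix W u i = ∑ i, u i := by
  simp only [mix]
  rw [sum_comm]
  simp only [← sum_smul]
  simp [sum_col_of_mem_doublyStochastic hW]

lemma mean_mix {E : Type*} [NormedAddCommGroup E] [InnerProductSpace ℝ E]
    {W : Matrix (Fin n) (Fin n) ℝ} (hW : W ∈ doublyStochastic ℝ (Fin n))
    (u : Fin n → E) : mean (mix W u) = mean u := by
  rw [mean, sum_mix hW, mean]

lemma lam_nonneg (W : Matrix (Fin n) (Fin n) ℝ) : 0 ≤ lam W := norm_nonneg _

lemma sum_sq_mulVec_le (A : Matrix (Fin n) (Fin n) ℝ) (v : Fin n → ℝ) :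
    ∑ i, (∑ r, A i r * v r) ^ 2 ≤
      ‖Matrix.toEuclideanCLM (𝕜 := ℝ) A‖ ^ 2 * ∑ i, v i ^ 2 := by
  have h := (Matrix.toEuclideanCLM (𝕜 := ℝ) A).le_opNorm (WithLp.toLp 2 v)
  have h2 := pow_le_pow_left₀ (norm_nonneg _) h 2
  rw [mul_pow, EuclideanSpace.norm_sq_eq, EuclideanSpace.norm_sq_eq] at h2
  simpa [Matrix.mulVec, dotProduct] using h2

lemma abs_entry_le (A : Matrix (Fin n) (Fin n) ℝ) (i r : Fin n) :
    |A i r| ≤ ‖Matrix.toEuclideanCLM (𝕜 := ℝ) A‖ := by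
  have h := sum_sq_mulVec_le A (Pi.single r 1)
  simp only [Pi.single_apply, mul_ite, mul_one, mul_zero, sum_ite_eq', mem_univ, if_true,
    ite_pow, one_pow, ne_eq, OfNat.ofNat_ne_zero, not_false_eq_true, zero_pow] at h
  refine abs_le_of_sq_le_sq (le_trans ?_ h) (norm_nonneg _)
  exact single_le_sum (f := fun i => A i r ^ 2) (fun _ _ => sq_nonneg _) (mem_univ i)

/-- A mixing round contracts the consensus error by the factor `lam W`: `W` fixes the consensus
component and acts on the rest as `W - W^∞`. -/
lemma dev_mix_le {p : ℕ} {W : Matrix (Fin n) (Fin n) ℝ}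
    (hW : W ∈ doublyStochastic ℝ (Fin n)) (u : Fin n → Vec p) :
    dev (mix W u) ≤ lam W * dev u := by
  rcases Nat.eq_zero_or_pos n with rfl | hn
  · simp [dev, stackNorm]
  refine (sq_le_sq₀ (dev_nonneg _) (mul_nonneg (lam_nonneg W) (dev_nonneg _))).mp ?_
  rw [mul_pow, dev, dev, stackNorm_sq, stackNorm_sq, mean_mix hW]
  set v : Fin n → Vec p := fun i => u i - mean u with hv
  have hsum : ∑ r, v r = 0 := by
    rw [hv, sum_sub_distrib, sum_eq_smul_mean hn]
    simp [← Nat.cast_smul_eq_nsmul ℝ]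
  have h1 (i : Fin n) : mix W u i - mean u = ∑ r, (W - Winf n) i r • v r := by
    have : ∑ r, (W - Winf n) i r • v r = ∑ r, W i r • v r := by
      simp only [Matrix.sub_apply, sub_smul, sum_sub_distrib, Winf]
      rw [← smul_sum, hsum, smul_zero, sub_zero]
    rw [this, hv]
    simp only [smul_sub, sum_sub_distrib, ← sum_smul]
    rw [sum_row_of_mem_doublyStochastic hW, one_smul]
    rfl
  simp only [h1, EuclideanSpace.norm_sq_eq]
  have hcomm (f : Fin n → Fin p → ℝ) : ∑ i, ∑ j, f i j = ∑ j, ∑ i, f i j := sum_comm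
  rw [hcomm, hcomm, mul_sum]
  refine sum_le_sum fun j _ => ?_
  simpa [lam, v] using sum_sq_mulVec_le (W - Winf n) fun r => v r j

/-- The powers of `W` converge to `W^∞` at the rate `lam W`. -/
lemma abs_pow_sub_le (hn : 0 < n) {W : Matrix (Fin n) (Fin n) ℝ}
    (hW : W ∈ doublyStochastic ℝ (Fin n)) (k : ℕ) (i r : Fin n) :
    |(W ^ k) i r - 1 / (n : ℝ)| ≤ lam W ^ k := by
  have hn' : (n : ℝ) ≠ 0 := by positivity
  have hJ : Winf n * Winf n = Winf n := by
    ext a b; simp [Matrix.mul_apply, Winf, hn']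
  have hWJ : W * Winf n = Winf n := by
    ext a b
    simp [Matrix.mul_apply, Winf, ← sum_mul, sum_row_of_mem_doublyStochastic hW]
  have hkJ (k : ℕ) : W ^ k * Winf n = Winf n := by
    induction k with
    | zero => simp
    | succ k ih => rw [pow_succ, Matrix.mul_assoc, hWJ, ih]
  rcases Nat.eq_zero_or_pos k with rfl | hk
  · have h1 : (1 : ℝ) ≤ n := by exact_mod_cast hn
    have h2 : 1 / (n : ℝ) ≤ 1 := by rw [div_le_one (by positivity)]; exact h1
    have h3 : 0 ≤ 1 / (n : ℝ) := by positivity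
    simp only [pow_zero, Matrix.one_apply]
    split_ifs <;> rw [abs_le] <;> constructor <;> linarith
  · have hJW : Winf n * W = Winf n := by
      ext a b
      simp [Matrix.mul_apply, Winf, ← mul_sum, sum_col_of_mem_doublyStochastic hW]
    have h : ∀ k : ℕ, (W - Winf n) ^ (k + 1) = W ^ (k + 1) - Winf n := by
      intro k
      induction k with
      | zero => simp
      | succ k ih =>
        rw [pow_succ, ih, Matrix.sub_mul, Matrix.mul_sub, Matrix.mul_sub, hkJ, hJ, hJW,
          ← pow_succ]
        abel
    obtain ⟨k, rfl⟩ : ∃ j, k = j + 1 := ⟨k - 1, by omega⟩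
    have e : (W ^ (k + 1)) i r - 1 / (n : ℝ) = ((W - Winf n) ^ (k + 1)) i r := by
      rw [h]; rfl
    rw [e]
    refine (abs_entry_le _ _ _).trans ?_
    rw [map_pow]
    exact norm_pow_le' _ (Nat.succ_pos k)

end Mix

/-! ### Strongly monotone Lipschitz maps -/

section Monotone

variable {E : Type*} [NormedAddCommGroup E] [InnerProductSpace ℝ E]

/-- A forward step along a strongly monotone Lipschitz map is a contraction. -/
lemma norm_forward_sub_le {T : E → E} {m ℓ t : ℝ} (ht : 0 ≤ t) (htl : t * ℓ ^ 2 ≤ m)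
    (hL : ∀ u v, ‖T u - T v‖ ≤ ℓ * ‖u - v‖)
    (hm : ∀ u v, m * ‖u - v‖ ^ 2 ≤ inner ℝ (T u - T v) (u - v)) (u v : E) :
    ‖(u - t • T u) - (v - t • T v)‖ ≤ (1 - t * m / 2) * ‖u - v‖ := by
  have e : (u - t • T u) - (v - t • T v) = (u - v) - t • (T u - T v) := by
    rw [smul_sub]; abel
  have h1 : ‖(u - v) - t • (T u - T v)‖ ^ 2 ≤ (1 - t * m) * ‖u - v‖ ^ 2 := by
    rw [norm_sub_sq_real, inner_smul_right, norm_smul, Real.norm_of_nonneg ht,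
      real_inner_comm]
    have h2 := pow_le_pow_left₀ (norm_nonneg _) (hL u v) 2
    have h3 := mul_le_mul_of_nonneg_left h2 (sq_nonneg t)
    have h4 := mul_le_mul_of_nonneg_left (hm u v) ht
    have h5 := mul_le_mul_of_nonneg_right (mul_le_mul_of_nonneg_left htl ht)
      (sq_nonneg ‖u - v‖)
    nlinarith
  rw [e]
  rcases (norm_nonneg (u - v)).eq_or_lt with h0 | h0
  · rw [← h0] at h1 ⊢
    have : ‖(u - v) - t • (T u - T v)‖ = 0 := by
      have : ‖(u - v) - t • (T u - T v)‖ ^ 2 ≤ 0 := by simpa using h1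
      exact pow_eq_zero_iff (two_ne_zero) |>.mp (le_antisymm this (sq_nonneg _))
    simp [this]
  · have h6 : 0 ≤ 1 - t * m := by
      have := (sq_nonneg _).trans h1
      by_contra hneg
      push Not at hneg
      nlinarith [pow_pos h0 2]
    refine (sq_le_sq₀ (norm_nonneg _) (mul_nonneg (by linarith) h0.le)).mp (h1.trans ?_)
    rw [mul_pow]
    refine mul_le_mul_of_nonneg_right ?_ (sq_nonneg _)
    nlinarith [sq_nonneg (t * m)]

/-- Strongly monotone Lipschitz maps of a complete space are surjective: a forward step for the
equation `T x = z` is a contraction, and its fixed point is a solution. -/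
lemma exists_eq_of_stronglyMonotone [CompleteSpace E] {T : E → E} {m ℓ : ℝ} (hm0 : 0 < m)
    (hℓ : 0 < ℓ) (hL : ∀ u v, ‖T u - T v‖ ≤ ℓ * ‖u - v‖)
    (hm : ∀ u v, m * ‖u - v‖ ^ 2 ≤ inner ℝ (T u - T v) (u - v)) (z : E) :
    ∃ x, T x = z := by
  set t := min (m / ℓ ^ 2) (1 / m) with ht
  have ht0 : 0 < t := by rw [ht]; positivity
  have htl : t * ℓ ^ 2 ≤ m := by
    rw [← le_div_iff₀ (by positivity)]; exact min_le_left _ _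
  have htm : t * m ≤ 1 := by
    rw [← le_div_iff₀ hm0]; exact min_le_right _ _
  have hT (u v : E) : ‖(u - t • (T u - z)) - (v - t • (T v - z))‖ ≤
      (1 - t * m / 2) * ‖u - v‖ :=
    norm_forward_sub_le (T := fun u => T u - z) ht0.le htl (by simpa using hL)
      (by simpa using hm) u v
  have hc : ContractingWith (1 - t * m / 2).toNNReal fun u => u - t • (T u - z) := by
    constructor
    · rw [Real.toNNReal_lt_one]
      have := mul_pos ht0 hm0
      linarith
    · refine LipschitzWith.of_dist_le_mul fun u v => ?_
      rw [dist_eq_norm, dist_eq_norm, Real.coe_toNNReal _ (by linarith)]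
      exact hT u v
  have hfix := hc.fixedPoint_isFixedPt
  set x := ContractingWith.fixedPoint _ hc
  refine ⟨x, ?_⟩
  have h : x - t • (T x - z) = x := hfix
  have h2 : t • (T x - z) = 0 := by simpa using h
  exact sub_eq_zero.mp ((smul_eq_zero.mp h2).resolve_left ht0.ne')

lemma eq_of_stronglyMonotone {T : E → E} {m : ℝ} (hm0 : 0 < m)
    (hm : ∀ u v, m * ‖u - v‖ ^ 2 ≤ inner ℝ (T u - T v) (u - v)) {u v : E} (h : T u = T v) :
    u = v := by
  have := hm u v
  rw [h, sub_self, inner_zero_left] at this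
  have h2 : ‖u - v‖ ^ 2 ≤ 0 := by nlinarith
  have h3 : ‖u - v‖ = 0 := by
    exact pow_eq_zero_iff two_ne_zero |>.mp (le_antisymm h2 (sq_nonneg _))
  exact sub_eq_zero.mp (norm_eq_zero.mp h3)

end Monotone

/-! ### Perturbed linear convergence -/

/-- A geometric recursion keeps a linear rate under a perturbation that dies out geometrically;
half of the margin `θ` is spent on the perturbation. -/
lemma exists_le_mul_pow {V : ℕ → ℝ} {θ l K : ℝ} {k₀ : ℕ} (hθ : 0 < θ) (hθ1 : θ ≤ 1)
    (hl : 0 ≤ l) (hlθ : l ≤ 1 - θ) (hK : 0 ≤ K) (hV : ∀ k, 0 ≤ V k)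
    (h : ∀ k, k₀ ≤ k → V (k + 1) ≤ (1 - θ) * V k + K * l ^ k * (V k + 1)) :
    ∃ ψ, 0 < ψ ∧ ∀ k, V k ≤ ψ * (1 - θ / 2) ^ k := by
  have hl1 : l < 1 := by linarith
  have hlim : Filter.Tendsto (fun k => K * l ^ k) Filter.atTop (nhds 0) := by
    simpa using (tendsto_pow_atTop_nhds_zero_of_lt_one hl hl1).const_mul K
  obtain ⟨k₁, hk₁⟩ := Filter.eventually_atTop.mp
    (hlim.eventually (ge_mem_nhds (show (0 : ℝ) < θ / 4 by positivity)))
  set k₂ := max k₀ k₁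
  have hρ : 0 < 1 - θ / 2 := by linarith
  set U : ℕ → ℝ := fun k => V k + 4 * K / θ * l ^ k with hU
  have hU0 (k : ℕ) : 0 ≤ U k := add_nonneg (hV k) (by positivity)
  have hstep (k : ℕ) (hk : k₂ ≤ k) : U (k + 1) ≤ (1 - θ / 2) * U k := by
    have h1 := h k ((le_max_left _ _).trans hk)
    have h2 := hk₁ k ((le_max_right _ _).trans hk)
    have h3 := mul_le_mul_of_nonneg_right h2 (hV k)
    have h4 : 4 * K / θ * l ^ (k + 1) ≤ 4 * K / θ * l ^ k * (1 - θ) := by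
      rw [pow_succ, mul_assoc (4 * K / θ)]
      refine mul_le_mul_of_nonneg_left ?_ (by positivity)
      exact mul_le_mul_of_nonneg_left hlθ (by positivity)
    have h5 : 4 * K / θ * l ^ k * θ = 4 * (K * l ^ k) := by field_simp
    have h6 : 0 ≤ K * l ^ k := by positivity
    have h7 := mul_nonneg hθ.le (hV k)
    simp only [hU]
    nlinarith
  set ψ := 1 + ∑ j ∈ range (k₂ + 1), U j / (1 - θ / 2) ^ j with hψ
  have hterm (j : ℕ) : 0 ≤ U j / (1 - θ / 2) ^ j := div_nonneg (hU0 j) (by positivity)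
  have hsmall (k : ℕ) (hk : k ≤ k₂) : U k ≤ ψ * (1 - θ / 2) ^ k := by
    rw [← div_le_iff₀ (by positivity)]
    have := single_le_sum (f := fun j => U j / (1 - θ / 2) ^ j) (fun j _ => hterm j)
      (mem_range.mpr (Nat.lt_succ_of_le hk))
    linarith
  have hbig (k : ℕ) (hk : k₂ ≤ k) : U k ≤ ψ * (1 - θ / 2) ^ k := by
    induction k, hk using Nat.le_induction with
    | base => exact hsmall _ le_rfl
    | succ k hk ih =>
      refine (hstep k hk).trans ?_
      rw [pow_succ]
      nlinarith
  refine ⟨ψ, ?_, fun k => ?_⟩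
  · have : 0 ≤ ∑ j ∈ range (k₂ + 1), U j / (1 - θ / 2) ^ j := sum_nonneg fun j _ => hterm j
    linarith
  · have h1 : V k ≤ U k := le_add_of_nonneg_right (by positivity)
    exact h1.trans ((le_total k k₂).elim (hsmall k) (hbig k))

/-! ### Gradients and singular values -/

section Calculus

variable {px py : ℕ}

/-- The continuous linear map of a matrix between Euclidean spaces. -/
noncomputable def opr (P : Matrix (Fin py) (Fin px) ℝ) : Vec px →L[ℝ] Vec py :=
  LinearMap.toContinuousLinearMap (Matrix.toEuclideanLin P)

lemma opr_apply (P : Matrix (Fin py) (Fin px) ℝ) (x : Vec px) :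
    opr P x = Matrix.toEuclideanLin P x := rfl

lemma opr_smul (c : ℝ) (P : Matrix (Fin py) (Fin px) ℝ) : opr (c • P) = c • opr P := by
  ext1 x; simp [opr_apply]

lemma opr_sum {ι : Type*} (s : Finset ι) (P : ι → Matrix (Fin py) (Fin px) ℝ) :
    opr (∑ i ∈ s, P i) = ∑ i ∈ s, opr (P i) := by
  ext1 x
  simp only [opr_apply, map_sum, LinearMap.sum_apply, _root_.sum_apply]

lemma norm_adjoint_apply_le (A : Vec px →L[ℝ] Vec py) (y : Vec py) :
    ‖ContinuousLinearMap.adjoint A y‖ ≤ ‖A‖ * ‖y‖ := by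
  have h := (ContinuousLinearMap.adjoint A).le_opNorm y
  rwa [LinearIsometryEquiv.norm_map] at h

lemma hasGradientAt_cost_left {g : Vec px → ℝ} {v x : Vec px} (h : Vec py → ℝ)
    (P : Matrix (Fin py) (Fin px) ℝ) (y : Vec py) (hg : HasGradientAt g v x) :
    HasGradientAt (fun x' => cost g h P x' y) (v + ContinuousLinearMap.adjoint (opr P) y) x := by
  rw [hasGradientAt_iff_hasFDerivAt] at hg ⊢
  have h2 := (hg.add ((innerSL ℝ y).comp (opr P)).hasFDerivAt).sub_const (h y)
  refine (h2.congr_fderiv ?_)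
  ext z
  simp [ContinuousLinearMap.adjoint_inner_left]

lemma hasGradientAt_cost_right (g : Vec px → ℝ) {h : Vec py → ℝ} {v y : Vec py}
    (P : Matrix (Fin py) (Fin px) ℝ) (x : Vec px) (hh : HasGradientAt h v y) :
    HasGradientAt (fun y' => cost g h P x y') (opr P x - v) y := by
  rw [hasGradientAt_iff_hasFDerivAt] at hh ⊢
  have h2 := ((innerSL ℝ (opr P x)).hasFDerivAt (x := y)).const_add (g x) |>.sub hh
  have e : (fun y' => cost g h P x y') = (fun y' => g x + innerSL ℝ (opr P x) y') - h := by
    funext y'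
    simp [cost, opr_apply, real_inner_comm]
  rw [e]
  refine (h2.congr_fderiv ?_)
  ext z
  simp

lemma gradX_eq {g : Vec px → ℝ} (hg : Differentiable ℝ g) (h : Vec py → ℝ)
    (P : Matrix (Fin py) (Fin px) ℝ) (x : Vec px) (y : Vec py) :
    gradX g h P x y = gradient g x + ContinuousLinearMap.adjoint (opr P) y :=
  (hasGradientAt_cost_left h P y (hg x).hasGradientAt).gradient

lemma gradY_eq (g : Vec px → ℝ) {h : Vec py → ℝ} (hh : Differentiable ℝ h)
    (P : Matrix (Fin py) (Fin px) ℝ) (x : Vec px) (y : Vec py) :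
    gradY g h P x y = opr P x - gradient h y :=
  (hasGradientAt_cost_right g P x (hh y).hasGradientAt).gradient

lemma hasGradientAt_average {n p : ℕ} {f : Fin n → Vec p → ℝ}
    (hf : ∀ i, Differentiable ℝ (f i)) (x : Vec p) :
    HasGradientAt (fun x => (1 / (n : ℝ)) * ∑ i, f i x)
      (mean fun i => gradient (f i) x) x := by
  rw [hasGradientAt_iff_hasFDerivAt]
  have h := (HasFDerivAt.fun_sum (u := univ) fun i _ =>
    (hf i x).hasGradientAt.hasFDerivAt).const_mul (1 / (n : ℝ))
  refine h.congr_fderiv ?_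
  simp [mean]

/-- First-order characterization of convexity. -/
lemma add_inner_le_of_convexOn {p : ℕ} {f : Vec p → ℝ} (hf : ConvexOn ℝ Set.univ f)
    {u d : Vec p} (hd : HasGradientAt f d u) (v : Vec p) :
    f u + inner ℝ d (v - u) ≤ f v := by
  have hl : HasDerivAt (fun t : ℝ => f (AffineMap.lineMap u v t)) (inner ℝ d (v - u)) 0 := by
    have h1 : HasDerivAt (fun t : ℝ => (AffineMap.lineMap u v t : Vec p)) (v - u) 0 :=
      AffineMap.hasDerivAt_lineMap
    have h2 : HasFDerivAt f (InnerProductSpace.toDual ℝ (Vec p) d)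
        (AffineMap.lineMap u v (0 : ℝ)) := by
      rw [AffineMap.lineMap_apply_zero]; exact hd.hasFDerivAt
    simpa [Function.comp_def] using h2.comp_hasDerivAt (0 : ℝ) h1
  have hc : ConvexOn ℝ Set.univ fun t : ℝ => f (AffineMap.lineMap u v t) := by
    simpa [Function.comp_def] using hf.comp_affineMap (AffineMap.lineMap (k := ℝ) u v)
  have h := hc.le_slope_of_hasDerivAt (Set.mem_univ 0) (Set.mem_univ 1) zero_lt_one hl
  simp [slope] at h
  linarith

lemma gradient_eq_zero_of_forall_le {p : ℕ} {f : Vec p → ℝ} {d u : Vec p}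
    (hd : HasGradientAt f d u) (h : ∀ v, f u ≤ f v) : d = 0 := by
  have h1 := (show IsLocalMin f u from Filter.Eventually.of_forall h).hasFDerivAt_eq_zero
    hd.hasFDerivAt
  simpa using h1

lemma norm_sq_eq_sum_eigenvalues (T : Vec px →ₗ[ℝ] Vec py)
    (hn : Module.finrank ℝ (Vec px) = px) (x : Vec px) :
    ‖T x‖ ^ 2 = ∑ i : Fin px, T.singularValues i ^ 2 *
      ((T.isSymmetric_adjoint_comp_self.eigenvectorBasis hn).repr x i) ^ 2 := by
  set b := T.isSymmetric_adjoint_comp_self.eigenvectorBasis hn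
  have h1 : ‖T x‖ ^ 2 = inner ℝ ((LinearMap.adjoint T ∘ₗ T) x) x := by
    rw [LinearMap.comp_apply, LinearMap.adjoint_inner_left, real_inner_self_eq_norm_sq]
  rw [h1, ← b.repr.inner_map_map, PiLp.inner_apply]
  refine sum_congr rfl fun i _ => ?_
  rw [LinearMap.IsSymmetric.eigenvectorBasis_apply_self_apply, ← T.sq_singularValues_fin hn i]
  simp [b]
  ring

lemma norm_apply_le_singularValues (T : Vec px →ₗ[ℝ] Vec py) (x : Vec px) :
    ‖T x‖ ≤ T.singularValues 0 * ‖x‖ := by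
  have hn : Module.finrank ℝ (Vec px) = px := by simp
  refine (sq_le_sq₀ (norm_nonneg _)
    (mul_nonneg (T.singularValues_nonneg 0) (norm_nonneg _))).mp ?_
  rw [norm_sq_eq_sum_eigenvalues T hn, mul_pow,
    ← (T.isSymmetric_adjoint_comp_self.eigenvectorBasis hn).repr.norm_map x,
    EuclideanSpace.norm_sq_eq, mul_sum]
  refine sum_le_sum fun i _ => ?_
  rw [Real.norm_eq_abs, sq_abs]
  exact mul_le_mul_of_nonneg_right (pow_le_pow_left₀ (T.singularValues_nonneg _)
    (T.singularValues_antitone (Nat.zero_le _)) 2) (sq_nonneg _)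

lemma singularValues_mul_le_norm_apply (T : Vec px →ₗ[ℝ] Vec py) (x : Vec px) :
    T.singularValues (px - 1) * ‖x‖ ≤ ‖T x‖ := by
  have hn : Module.finrank ℝ (Vec px) = px := by simp
  refine (sq_le_sq₀ (mul_nonneg (T.singularValues_nonneg _) (norm_nonneg _))
    (norm_nonneg _)).mp ?_
  rw [norm_sq_eq_sum_eigenvalues T hn, mul_pow,
    ← (T.isSymmetric_adjoint_comp_self.eigenvectorBasis hn).repr.norm_map x,
    EuclideanSpace.norm_sq_eq, mul_sum]
  refine sum_le_sum fun i _ => ?_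
  rw [Real.norm_eq_abs, sq_abs]
  exact mul_le_mul_of_nonneg_right (pow_le_pow_left₀ (T.singularValues_nonneg _)
    (T.singularValues_antitone (by omega)) 2) (sq_nonneg _)

end Calculus

/-! ### The saddle point -/

namespace Problem

variable {n px py : ℕ} (D : Problem n px py)

/-- The gradient of `G`, as the average of the local gradients. -/
noncomputable def gradG (x : Vec px) : Vec px := mean fun i => gradient (D.g i) x

/-- The gradient of `H`, as the average of the local gradients. -/
noncomputable def gradH (y : Vec py) : Vec py := mean fun i => gradient (D.h i) y

/-- The maximizer of `⟨y, z⟩ - H y`, as the inverse of `∇H` at `z`. -/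
noncomputable def bestResponse (z : Vec py) : Vec py := Function.invFun D.gradH z

/-- The gradient of the primal function `x ↦ max_y F (x, y)`. -/
noncomputable def gradPrimal (x : Vec px) : Vec px :=
  D.gradG x + ContinuousLinearMap.adjoint (opr D.Pbar) (D.bestResponse (opr D.Pbar x))

/-- The standing assumptions on a problem, in the form in which the analysis uses them: a common
smoothness constant, and the extreme singular values of `P̄` as bounds on its action. -/
structure WellPosed (L μ σm σM : ℝ) : Prop where
  n_pos : 0 < n
  L_pos : 0 < L
  μ_pos : 0 < μ
  σm_pos : 0 < σm
  σM_pos : 0 < σM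
  smooth_g : ∀ i, IsSmooth L (D.g i)
  smooth_h : ∀ i, IsSmooth L (D.h i)
  convex : ConvexOn ℝ Set.univ D.G
  strong : IsStronglyConvex μ D.H
  upper : ∀ x, ‖opr D.Pbar x‖ ≤ σM * ‖x‖
  lower : ∀ x, σm * ‖x‖ ≤ ‖opr D.Pbar x‖

variable {D} {L μ σm σM : ℝ}

lemma norm_mean_sub_le {p : ℕ} (hn : 0 < n) {γ : Fin n → Vec p → Vec p}
    (h : ∀ i u v, ‖γ i u - γ i v‖ ≤ L * ‖u - v‖) (u v : Vec p) :
    ‖mean (fun i => γ i u) - mean (fun i => γ i v)‖ ≤ L * ‖u - v‖ := by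
  rw [← mean_sub, mean, norm_smul, Real.norm_of_nonneg (by positivity)]
  have h1 := norm_sum_le_of_le univ fun i _ => h i u v
  rw [sum_const, card_univ, Fintype.card_fin, nsmul_eq_mul] at h1
  have hn' : (0 : ℝ) < n := by exact_mod_cast hn
  calc _ ≤ 1 / (n : ℝ) * (n * (L * ‖u - v‖)) := by gcongr
    _ = _ := by field_simp

lemma F_eq (x : Vec px) (y : Vec py) :
    D.F x y = cost D.G D.H D.Pbar x y := by
  simp only [F, cost, G, H, ← opr_apply, Pbar, opr_smul, opr_sum, sum_add_distrib,
    sum_sub_distrib, _root_.smul_apply, _root_.sum_apply,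
    inner_smul_right, inner_sum]
  ring

namespace WellPosed

variable (hD : D.WellPosed L μ σm σM)
include hD

lemma hasGradientAt_G (x : Vec px) : HasGradientAt D.G (D.gradG x) x :=
  hasGradientAt_average (fun i => (hD.smooth_g i).1) x

lemma hasGradientAt_H (y : Vec py) : HasGradientAt D.H (D.gradH y) y :=
  hasGradientAt_average (fun i => (hD.smooth_h i).1) y

lemma norm_gradG_sub_le (u v : Vec px) : ‖D.gradG u - D.gradG v‖ ≤ L * ‖u - v‖ :=
  norm_mean_sub_le hD.n_pos (fun i => (hD.smooth_g i).2) u v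

lemma norm_gradH_sub_le (u v : Vec py) : ‖D.gradH u - D.gradH v‖ ≤ L * ‖u - v‖ :=
  norm_mean_sub_le hD.n_pos (fun i => (hD.smooth_h i).2) u v

lemma inner_gradG_nonneg (u v : Vec px) : 0 ≤ inner ℝ (D.gradG u - D.gradG v) (u - v) := by
  have h1 := add_inner_le_of_convexOn hD.convex (hD.hasGradientAt_G u) v
  have h2 := add_inner_le_of_convexOn hD.convex (hD.hasGradientAt_G v) u
  rw [← neg_sub u v, inner_neg_right] at h1
  rw [inner_sub_left]
  linarith

lemma inner_gradH_ge (u v : Vec py) :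
    μ * ‖u - v‖ ^ 2 ≤ inner ℝ (D.gradH u - D.gradH v) (u - v) := by
  have h1 := hD.strong.2 u v
  have h2 := hD.strong.2 v u
  rw [(hD.hasGradientAt_H _).gradient] at h1 h2
  rw [← neg_sub u v, inner_neg_right, norm_neg] at h2
  rw [inner_sub_left]
  linarith

lemma gradH_bestResponse (z : Vec py) : D.gradH (D.bestResponse z) = z :=
  Function.invFun_eq (exists_eq_of_stronglyMonotone hD.μ_pos hD.L_pos hD.norm_gradH_sub_le
    hD.inner_gradH_ge z)

lemma norm_bestResponse_sub_le (z w : Vec py) :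
    ‖D.bestResponse z - D.bestResponse w‖ ≤ 1 / μ * ‖z - w‖ := by
  have h := hD.inner_gradH_ge (D.bestResponse z) (D.bestResponse w)
  rw [hD.gradH_bestResponse, hD.gradH_bestResponse] at h
  have h2 := h.trans (real_inner_le_norm _ _)
  have hμ := hD.μ_pos
  rw [one_div, inv_mul_eq_div, le_div_iff₀ hμ]
  rcases (norm_nonneg (D.bestResponse z - D.bestResponse w)).eq_or_lt with h0 | h0
  · rw [← h0]; simp
  · nlinarith

lemma inner_bestResponse_ge (z w : Vec py) :
    μ / L ^ 2 * ‖z - w‖ ^ 2 ≤ inner ℝ (D.bestResponse z - D.bestResponse w) (z - w) := by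
  have h := hD.inner_gradH_ge (D.bestResponse z) (D.bestResponse w)
  have h1 := hD.norm_gradH_sub_le (D.bestResponse z) (D.bestResponse w)
  rw [hD.gradH_bestResponse, hD.gradH_bestResponse] at h h1
  rw [real_inner_comm] at h
  refine le_trans ?_ h
  have h2 := pow_le_pow_left₀ (norm_nonneg _) h1 2
  have hL := hD.L_pos
  rw [div_mul_eq_mul_div, div_le_iff₀ (by positivity), mul_assoc]
  refine mul_le_mul_of_nonneg_left ?_ hD.μ_pos.le
  linarith [mul_pow L ‖D.bestResponse z - D.bestResponse w‖ 2]

lemma norm_opr_le : ‖opr D.Pbar‖ ≤ σM :=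
  ContinuousLinearMap.opNorm_le_bound _ hD.σM_pos.le hD.upper

lemma norm_adjoint_le (y : Vec py) :
    ‖ContinuousLinearMap.adjoint (opr D.Pbar) y‖ ≤ σM * ‖y‖ :=
  (norm_adjoint_apply_le _ y).trans
    (mul_le_mul_of_nonneg_right hD.norm_opr_le (norm_nonneg _))

lemma norm_response_sub_le (u v : Vec px) :
    ‖D.bestResponse (opr D.Pbar u) - D.bestResponse (opr D.Pbar v)‖ ≤
      σM / μ * ‖u - v‖ := by
  refine (hD.norm_bestResponse_sub_le _ _).trans ?_
  have hμ := hD.μ_pos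
  rw [← map_sub]
  calc _ ≤ 1 / μ * (σM * ‖u - v‖) := by gcongr; exact hD.upper _
    _ = _ := by ring

lemma norm_gradPrimal_sub_le (u v : Vec px) :
    ‖D.gradPrimal u - D.gradPrimal v‖ ≤ (L + σM * (σM / μ)) * ‖u - v‖ := by
  have e : D.gradPrimal u - D.gradPrimal v = (D.gradG u - D.gradG v) +
      ContinuousLinearMap.adjoint (opr D.Pbar)
        (D.bestResponse (opr D.Pbar u) - D.bestResponse (opr D.Pbar v)) := by
    simp only [gradPrimal, map_sub]; abel
  rw [e, add_mul, mul_assoc]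
  refine (norm_add_le _ _).trans (add_le_add (hD.norm_gradG_sub_le u v) ?_)
  exact (hD.norm_adjoint_le _).trans
    (mul_le_mul_of_nonneg_left (hD.norm_response_sub_le u v) hD.σM_pos.le)

/-- The primal function inherits strong convexity from the coupling: `∇H⁻¹` is strongly monotone
and `P̄` is bounded below. -/
lemma inner_gradPrimal_ge (u v : Vec px) :
    σm ^ 2 * μ / L ^ 2 * ‖u - v‖ ^ 2 ≤
      inner ℝ (D.gradPrimal u - D.gradPrimal v) (u - v) := by
  have e : D.gradPrimal u - D.gradPrimal v = (D.gradG u - D.gradG v) +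
      ContinuousLinearMap.adjoint (opr D.Pbar)
        (D.bestResponse (opr D.Pbar u) - D.bestResponse (opr D.Pbar v)) := by
    simp only [gradPrimal, map_sub]; abel
  rw [e, inner_add_left, ContinuousLinearMap.adjoint_inner_left]
  have h1 := hD.inner_gradG_nonneg u v
  have h2 := hD.inner_bestResponse_ge (opr D.Pbar u) (opr D.Pbar v)
  rw [← map_sub] at h2
  have h3 := pow_le_pow_left₀ (mul_nonneg hD.σm_pos.le (norm_nonneg _)) (hD.lower (u - v)) 2
  have h4 := mul_le_mul_of_nonneg_left h3
    (show 0 ≤ μ / L ^ 2 from div_nonneg hD.μ_pos.le (sq_nonneg _))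
  calc _ = μ / L ^ 2 * (σm * ‖u - v‖) ^ 2 := by ring
    _ ≤ _ := by linarith

lemma modulus_pos : 0 < σm ^ 2 * μ / L ^ 2 := by
  have := hD.σm_pos; have := hD.μ_pos; have := hD.L_pos
  positivity

/-- Saddle points are the common zeros of the two partial gradients. -/
lemma isSaddle_iff (a : Vec px) (b : Vec py) :
    D.IsSaddle a b ↔ D.gradPrimal a = 0 ∧ b = D.bestResponse (opr D.Pbar a) := by
  have hX := hasGradientAt_cost_left D.H D.Pbar b (hD.hasGradientAt_G a)
  have hY := hasGradientAt_cost_right D.G D.Pbar a (hD.hasGradientAt_H b)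
  simp only [IsSaddle, F_eq]
  constructor
  · rintro ⟨h1, h2⟩
    have h3 := gradient_eq_zero_of_forall_le hX h2
    have h4 : opr D.Pbar a - D.gradH b = 0 := by
      have hneg : HasGradientAt (fun y => -cost D.G D.H D.Pbar a y)
          (-(opr D.Pbar a - D.gradH b)) b := by
        rw [hasGradientAt_iff_hasFDerivAt, map_neg]
        exact hY.hasFDerivAt.neg
      have := gradient_eq_zero_of_forall_le hneg fun v => neg_le_neg (h1 v)
      exact neg_eq_zero.mp this
    have h5 : b = D.bestResponse (opr D.Pbar a) := by
      refine eq_of_stronglyMonotone hD.μ_pos hD.inner_gradH_ge ?_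
      rw [hD.gradH_bestResponse]
      exact (sub_eq_zero.mp h4).symm
    refine ⟨?_, h5⟩
    rw [gradPrimal, ← h5]
    exact h3
  · rintro ⟨h1, h2⟩
    rw [gradPrimal, ← h2] at h1
    have h3 : D.gradH b = opr D.Pbar a := by rw [h2, hD.gradH_bestResponse]
    refine ⟨fun y => ?_, fun x => ?_⟩
    · have h4 := hD.strong.2 y b
      rw [(hD.hasGradientAt_H b).gradient, h3, inner_sub_right, real_inner_comm,
        real_inner_comm b] at h4
      have h5 : 0 ≤ μ / 2 * ‖y - b‖ ^ 2 := by
        have := hD.μ_pos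
        positivity
      simp only [cost, ← opr_apply]
      linarith
    · have h4 := add_inner_le_of_convexOn hD.convex (hD.hasGradientAt_G a) x
      have h5 : inner ℝ (D.gradG a) (x - a) =
          -inner ℝ b (opr D.Pbar (x - a)) := by
        rw [eq_neg_of_add_eq_zero_left h1, inner_neg_left,
          ContinuousLinearMap.adjoint_inner_left]
      rw [h5, map_sub, inner_sub_right] at h4
      simp only [cost, ← opr_apply]
      linarith

lemma exists_gradPrimal_eq_zero : ∃ xs, D.gradPrimal xs = 0 := by
  have := hD.L_pos; have := hD.σM_pos; have := hD.μ_pos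
  exact exists_eq_of_stronglyMonotone hD.modulus_pos
    (show 0 < L + σM * (σM / μ) by positivity) hD.norm_gradPrimal_sub_le
    hD.inner_gradPrimal_ge 0

lemma μ_le_L (hpx : 0 < px) : μ ≤ L := by
  have : Nonempty (Fin px) := ⟨⟨0, hpx⟩⟩
  obtain ⟨x, hx⟩ := exists_ne (0 : Vec px)
  have hy : 0 < ‖opr D.Pbar x - 0‖ := by
    rw [sub_zero]
    exact (mul_pos hD.σm_pos (norm_pos_iff.mpr hx)).trans_le (hD.lower x)
  have h1 := (hD.inner_gradH_ge (opr D.Pbar x) 0).trans (real_inner_le_norm _ _)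
  have h2 := mul_le_mul_of_nonneg_right (hD.norm_gradH_sub_le (opr D.Pbar x) 0) hy.le
  have h3 : μ * ‖opr D.Pbar x - 0‖ ^ 2 ≤ L * ‖opr D.Pbar x - 0‖ ^ 2 := by
    nlinarith
  exact le_of_mul_le_mul_right h3 (by positivity)

end WellPosed

lemma sigmaMin_pos (hpx : 0 < px) (hr : D.Pbar.rank = px) : 0 < D.sigmaMin := by
  rw [sigmaMin, LinearMap.singularValues_pos_iff_lt_finrank_range]
  have : Module.finrank ℝ (Matrix.toEuclideanLin D.Pbar).range = px := by
    rw [Matrix.toEuclideanLin_eq_toLin_orthonormal, ← Matrix.rank_eq_finrank_range_toLin]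
    exact hr
  omega

lemma sigmaMin_le_sigmaMax : D.sigmaMin ≤ D.sigmaMax :=
  LinearMap.singularValues_antitone _ (Nat.zero_le _)

lemma wellPosed {L₁ L₂ : ℝ} (hn : 0 < n) (hpx : 0 < px) (hL₁ : 0 < L₁) (hμ : 0 < μ)
    (hg : ∀ i, IsSmooth L₁ (D.g i)) (hh : ∀ i, IsSmooth L₂ (D.h i))
    (hG : ConvexOn ℝ Set.univ D.G) (hH : IsStronglyConvex μ D.H) (hr : D.Pbar.rank = px) :
    D.WellPosed (max L₁ L₂) μ D.sigmaMin D.sigmaMax where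
  n_pos := hn
  L_pos := lt_max_of_lt_left hL₁
  μ_pos := hμ
  σm_pos := sigmaMin_pos hpx hr
  σM_pos := (sigmaMin_pos hpx hr).trans_le sigmaMin_le_sigmaMax
  smooth_g i := ⟨(hg i).1, fun u v => ((hg i).2 u v).trans
    (mul_le_mul_of_nonneg_right (le_max_left _ _) (norm_nonneg _))⟩
  smooth_h i := ⟨(hh i).1, fun u v => ((hh i).2 u v).trans
    (mul_le_mul_of_nonneg_right (le_max_right _ _) (norm_nonneg _))⟩
  convex := hG
  strong := hH
  upper := norm_apply_le_singularValues _
  lower := singularValues_mul_le_norm_apply _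

end Problem

/-! ### Invariants of the iteration -/

section Invariants

variable {n px py : ℕ}

/-- The stored gradients are the local partial gradients at the current iterates, and the trackers
have the same averages as the stored gradients. -/
structure Tracks (D : Problem n px py) (s : State n px py) : Prop where
  gx_eq : s.gx = fun i => gradX (D.g i) (D.h i) (s.P i) (s.x i) (s.y i)
  gy_eq : s.gy = fun i => gradY (D.g i) (D.h i) (s.P i) (s.x i) (s.y i)
  mean_q : mean s.q = mean s.gx
  mean_w : mean s.w = mean s.gy

variable {D : Problem n px py} {W : Matrix (Fin n) (Fin n) ℝ} {α β : ℝ}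

lemma step_q (s : State n px py) : (step D W α β s).q =
    mix W fun r => s.q r + ((step D W α β s).gx r - s.gx r) := by
  simp only [← add_sub_assoc]; rfl

lemma step_w (s : State n px py) : (step D W α β s).w =
    mix W fun r => s.w r + ((step D W α β s).gy r - s.gy r) := by
  simp only [← add_sub_assoc]; rfl

lemma mean_step_x (hW : W ∈ doublyStochastic ℝ (Fin n)) (s : State n px py) :
    mean (step D W α β s).x = mean s.x - α • mean s.q := by
  change mean (mix W fun r => s.x r - α • s.q r) = _
  rw [mean_mix hW, mean_sub, mean_smul]

lemma mean_step_y (hW : W ∈ doublyStochastic ℝ (Fin n)) (s : State n px py) :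
    mean (step D W α β s).y = mean s.y + β • mean s.w := by
  change mean (mix W fun r => s.y r + β • s.w r) = _
  rw [mean_mix hW, mean_add, mean_smul]

lemma Tracks.step (hW : W ∈ doublyStochastic ℝ (Fin n)) {s : State n px py}
    (h : Tracks D s) : Tracks D (step D W α β s) where
  gx_eq := rfl
  gy_eq := rfl
  mean_q := by rw [step_q, mean_mix hW, mean_add, mean_sub, h.mean_q]; abel
  mean_w := by rw [step_w, mean_mix hW, mean_add, mean_sub, h.mean_w]; abel

lemma run_succ (x0 : Fin n → Vec px) (y0 : Fin n → Vec py) (k : ℕ) :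
    run D W α β x0 y0 (k + 1) = step D W α β (run D W α β x0 y0 k) :=
  Function.iterate_succ_apply' _ _ _

lemma tracks_run (hW : W ∈ doublyStochastic ℝ (Fin n)) (x0 : Fin n → Vec px)
    (y0 : Fin n → Vec py) (k : ℕ) : Tracks D (run D W α β x0 y0 k) := by
  induction k with
  | zero => exact ⟨rfl, rfl, rfl, rfl⟩
  | succ k ih => rw [run_succ]; exact ih.step hW

lemma run_P (x0 : Fin n → Vec px) (y0 : Fin n → Vec py) (k : ℕ) :
    (run D W α β x0 y0 k).P = mix (W ^ k) D.P := by
  induction k with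
  | zero => rw [pow_zero, mix_one]; rfl
  | succ k ih =>
    rw [run_succ, pow_succ', ← mix_mix, ← ih]; rfl

lemma run_evals (x0 : Fin n → Vec px) (y0 : Fin n → Vec py) (k : ℕ) (i : Fin n) :
    (run D W α β x0 y0 k).evals i = 2 * (k + 1) := by
  induction k with
  | zero => rfl
  | succ k ih =>
    rw [run_succ]
    change (run D W α β x0 y0 k).evals i + 2 = _
    omega

/-- The local copies of the coupling matrix converge to `P̄` at the rate `lam W`. -/
lemma norm_opr_run_P_sub_le (hn : 0 < n) (hW : W ∈ doublyStochastic ℝ (Fin n))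
    (x0 : Fin n → Vec px) (y0 : Fin n → Vec py) (k : ℕ) (i : Fin n) :
    ‖opr ((run D W α β x0 y0 k).P i) - opr D.Pbar‖ ≤ (∑ r, ‖opr (D.P r)‖) * lam W ^ k := by
  have e : opr ((run D W α β x0 y0 k).P i) - opr D.Pbar =
      ∑ r, ((W ^ k) i r - 1 / (n : ℝ)) • opr (D.P r) := by
    simp only [run_P, mix, Problem.Pbar, opr_sum, opr_smul, smul_sum]
    rw [← sum_sub_distrib]
    exact sum_congr rfl fun r _ => (sub_smul _ _ _).symm
  rw [e, sum_mul]
  refine norm_sum_le_of_le _ fun r _ => ?_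
  rw [norm_smul, mul_comm]
  exact mul_le_mul_of_nonneg_left (abs_pow_sub_le hn hW k i r) (norm_nonneg _)

end Invariants

/-! ### One iteration -/

section Step

variable {n px py : ℕ}

lemma mean_map {E F : Type*} [NormedAddCommGroup E] [InnerProductSpace ℝ E]
    [NormedAddCommGroup F] [InnerProductSpace ℝ F] (A : E →L[ℝ] F) (u : Fin n → E) :
    mean (fun i => A (u i)) = A (mean u) := by
  simp [mean]

lemma stackNorm_sub_le_dev {p : ℕ} (u v : Fin n → Vec p) :
    stackNorm (fun i => u i - v i) ≤ dev u + dev v + √n * ‖mean u - mean v‖ := by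
  have e : (fun i => u i - v i) =
      fun i => ((u i - mean u) - (v i - mean v)) + (mean u - mean v) := by
    funext i; abel
  rw [e, ← stackNorm_const]
  refine (stackNorm_add_le _ _).trans ?_
  exact add_le_add (stackNorm_sub_le _ _) le_rfl

/-- `√n ‖x̄ - a‖`, the distance of the average descent iterate from `a`. -/
noncomputable def distX (s : State n px py) (a : Vec px) : ℝ := √n * ‖mean s.x - a‖

/-- `√n ‖ȳ - y*(x̄)‖`, the distance of the average ascent iterate from the best response to the
average descent iterate. -/
noncomputable def gapY (D : Problem n px py) (s : State n px py) : ℝ :=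
  √n * ‖mean s.y - D.bestResponse (opr D.Pbar (mean s.x))‖

variable {D : Problem n px py} {L μ σm σM δ : ℝ} {s s' : State n px py}

lemma distX_nonneg (s : State n px py) (a : Vec px) : 0 ≤ distX s a := by
  unfold distX; positivity

lemma gapY_nonneg (s : State n px py) : 0 ≤ gapY D s := by
  unfold gapY; positivity

/-- The average descent tracker is the gradient of the primal function at `x̄`, up to the consensus
error in `x`, the gap of `ȳ` and the disagreement `δ` of the coupling matrices. -/
lemma sqrt_mul_norm_mean_q_sub_le (hD : D.WellPosed L μ σm σM) (hs : Tracks D s)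
    (hP : ∀ i, ‖opr (s.P i) - opr D.Pbar‖ ≤ δ) (hδ : 0 ≤ δ) :
    √n * ‖mean s.q - D.gradPrimal (mean s.x)‖ ≤
      L * dev s.x + σM * gapY D s + δ * stackNorm s.y := by
  set A := opr D.Pbar
  set z := D.bestResponse (A (mean s.x))
  set u : Fin n → Vec px := fun i => gradient (D.g i) (s.x i) - gradient (D.g i) (mean s.x)
  set v : Fin n → Vec px := fun i => ContinuousLinearMap.adjoint (opr (s.P i) - A) (s.y i)
  have e : s.gx = fun i => (u i + v i) +
      (gradient (D.g i) (mean s.x) + ContinuousLinearMap.adjoint A (s.y i)) := by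
    rw [hs.gx_eq]
    funext i
    rw [gradX_eq (hD.smooth_g i).1]
    simp only [u, v, map_sub, _root_.sub_apply]
    abel
  have e2 : mean s.q - D.gradPrimal (mean s.x) =
      mean u + mean v + ContinuousLinearMap.adjoint A (mean s.y - z) := by
    rw [hs.mean_q, e, mean_add, mean_add, mean_add, mean_map, map_sub, Problem.gradPrimal,
      Problem.gradG]
    abel
  have hu : √n * ‖mean u‖ ≤ L * dev s.x :=
    (sqrt_mul_norm_mean_le hD.n_pos u).trans
      (stackNorm_le_of_le hD.L_pos.le fun i => (hD.smooth_g i).2 _ _)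
  have hv : √n * ‖mean v‖ ≤ δ * stackNorm s.y :=
    (sqrt_mul_norm_mean_le hD.n_pos v).trans
      (stackNorm_le_of_le hδ fun i => (norm_adjoint_apply_le _ _).trans
        (mul_le_mul_of_nonneg_right (hP i) (norm_nonneg _)))
  have hz : √n * ‖ContinuousLinearMap.adjoint A (mean s.y - z)‖ ≤ σM * gapY D s := by
    rw [gapY, mul_left_comm]
    exact mul_le_mul_of_nonneg_left (hD.norm_adjoint_le _) (Real.sqrt_nonneg _)
  rw [e2]
  have h3 := mul_le_mul_of_nonneg_left
    (norm_add₃_le (a := mean u) (b := mean v)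
      (c := ContinuousLinearMap.adjoint A (mean s.y - z))) (Real.sqrt_nonneg n)
  linarith

/-- The average ascent tracker is the gradient in `y` at the averages `(x̄, ȳ)`, up to the consensus
error in `y` and the disagreement `δ` of the coupling matrices. -/
lemma sqrt_mul_norm_mean_w_sub_le (hD : D.WellPosed L μ σm σM) (hs : Tracks D s)
    (hP : ∀ i, ‖opr (s.P i) - opr D.Pbar‖ ≤ δ) (hδ : 0 ≤ δ) :
    √n * ‖mean s.w - (opr D.Pbar (mean s.x) - D.gradH (mean s.y))‖ ≤
      L * dev s.y + δ * stackNorm s.x := by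
  set A := opr D.Pbar
  set u : Fin n → Vec py := fun i => gradient (D.h i) (s.y i) - gradient (D.h i) (mean s.y)
  set v : Fin n → Vec py := fun i => (opr (s.P i) - A) (s.x i)
  have e : s.gy = fun i => (v i - u i) + (A (s.x i) - gradient (D.h i) (mean s.y)) := by
    rw [hs.gy_eq]
    funext i
    rw [gradY_eq _ (hD.smooth_h i).1]
    simp only [u, v, _root_.sub_apply]
    abel
  have e2 : mean s.w - (A (mean s.x) - D.gradH (mean s.y)) = mean v - mean u := by
    rw [hs.mean_w, e, mean_add, mean_sub v u, mean_sub fun i => A (s.x i), mean_map,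
      Problem.gradH]
    abel
  have hu : √n * ‖mean u‖ ≤ L * dev s.y :=
    (sqrt_mul_norm_mean_le hD.n_pos u).trans
      (stackNorm_le_of_le hD.L_pos.le fun i => (hD.smooth_h i).2 _ _)
  have hv : √n * ‖mean v‖ ≤ δ * stackNorm s.x :=
    (sqrt_mul_norm_mean_le hD.n_pos v).trans
      (stackNorm_le_of_le hδ fun i => ((opr (s.P i) - A).le_opNorm _).trans
        (mul_le_mul_of_nonneg_right (hP i) (norm_nonneg _)))
  rw [e2]
  have h3 := mul_le_mul_of_nonneg_left (norm_sub_le (mean v) (mean u)) (Real.sqrt_nonneg n)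
  linarith

lemma sqrt_mul_norm_mean_q_le (hD : D.WellPosed L μ σm σM) (hs : Tracks D s)
    (hP : ∀ i, ‖opr (s.P i) - opr D.Pbar‖ ≤ δ) (hδ : 0 ≤ δ) {a : Vec px}
    (ha : D.gradPrimal a = 0) :
    √n * ‖mean s.q‖ ≤ (L + σM * (σM / μ)) * distX s a +
      (L * dev s.x + σM * gapY D s + δ * stackNorm s.y) := by
  have h1 := sqrt_mul_norm_mean_q_sub_le hD hs hP hδ
  have h2 := hD.norm_gradPrimal_sub_le (mean s.x) a
  rw [ha, sub_zero] at h2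
  have h3 := norm_add_le (D.gradPrimal (mean s.x)) (mean s.q - D.gradPrimal (mean s.x))
  rw [add_sub_cancel] at h3
  have h4 := mul_le_mul_of_nonneg_left (h3.trans (add_le_add_left h2 _)) (Real.sqrt_nonneg n)
  rw [distX]
  linarith

lemma sqrt_mul_norm_mean_w_le (hD : D.WellPosed L μ σm σM) (hs : Tracks D s)
    (hP : ∀ i, ‖opr (s.P i) - opr D.Pbar‖ ≤ δ) (hδ : 0 ≤ δ) :
    √n * ‖mean s.w‖ ≤ L * gapY D s + (L * dev s.y + δ * stackNorm s.x) := by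
  have h1 := sqrt_mul_norm_mean_w_sub_le hD hs hP hδ
  set z := opr D.Pbar (mean s.x) - D.gradH (mean s.y) with hz
  have h2 : ‖z‖ ≤ L * ‖mean s.y - D.bestResponse (opr D.Pbar (mean s.x))‖ := by
    have := hD.norm_gradH_sub_le (mean s.y) (D.bestResponse (opr D.Pbar (mean s.x)))
    rwa [hD.gradH_bestResponse, norm_sub_rev] at this
  have h3 := norm_add_le z (mean s.w - z)
  rw [add_sub_cancel] at h3
  have h4 := mul_le_mul_of_nonneg_left (h3.trans (add_le_add_left h2 _)) (Real.sqrt_nonneg n)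
  rw [gapY]
  linarith

lemma norm_opr_le_two_mul (hD : D.WellPosed L μ σm σM) (hδM : δ ≤ σM)
    {P : Matrix (Fin py) (Fin px) ℝ} (hP : ‖opr P - opr D.Pbar‖ ≤ δ) :
    ‖opr P‖ ≤ 2 * σM := by
  have h1 := norm_add_le (opr P - opr D.Pbar) (opr D.Pbar)
  rw [sub_add_cancel] at h1
  linarith [hD.norm_opr_le]

lemma norm_opr_sub_le {P P' : Matrix (Fin py) (Fin px) ℝ}
    (hP : ‖opr P - opr D.Pbar‖ ≤ δ) (hP' : ‖opr P' - opr D.Pbar‖ ≤ δ) :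
    ‖opr P' - opr P‖ ≤ 2 * δ := by
  have h1 := norm_sub_le (opr P' - opr D.Pbar) (opr P - opr D.Pbar)
  rw [sub_sub_sub_cancel_right] at h1
  linarith

lemma stackNorm_gx_sub_le (hD : D.WellPosed L μ σm σM) (hs : Tracks D s) (hs' : Tracks D s')
    (hP : ∀ i, ‖opr (s.P i) - opr D.Pbar‖ ≤ δ) (hP' : ∀ i, ‖opr (s'.P i) - opr D.Pbar‖ ≤ δ)
    (hδ : 0 ≤ δ) (hδM : δ ≤ σM) :
    stackNorm (fun i => s'.gx i - s.gx i) ≤ L * stackNorm (fun i => s'.x i - s.x i) +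
      2 * σM * stackNorm (fun i => s'.y i - s.y i) + 2 * δ * stackNorm s.y := by
  have e : (fun i => s'.gx i - s.gx i) = fun i =>
      ((gradient (D.g i) (s'.x i) - gradient (D.g i) (s.x i)) +
        ContinuousLinearMap.adjoint (opr (s'.P i)) (s'.y i - s.y i)) +
        ContinuousLinearMap.adjoint (opr (s'.P i) - opr (s.P i)) (s.y i) := by
    funext i
    simp only [hs.gx_eq, hs'.gx_eq]
    rw [gradX_eq (hD.smooth_g i).1, gradX_eq (hD.smooth_g i).1]
    simp only [map_sub, _root_.sub_apply]
    abel
  rw [e]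
  refine (stackNorm_add_le _ _).trans (add_le_add ((stackNorm_add_le _ _).trans
    (add_le_add ?_ ?_)) ?_)
  · exact stackNorm_le_of_le hD.L_pos.le fun i => (hD.smooth_g i).2 _ _
  · exact stackNorm_le_of_le (by linarith [hD.σM_pos]) fun i =>
      (norm_adjoint_apply_le _ _).trans (mul_le_mul_of_nonneg_right
        (norm_opr_le_two_mul hD hδM (hP' i)) (norm_nonneg _))
  · exact stackNorm_le_of_le (by linarith) fun i =>
      (norm_adjoint_apply_le _ _).trans (mul_le_mul_of_nonneg_right
        (norm_opr_sub_le (hP i) (hP' i)) (norm_nonneg _))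

lemma stackNorm_gy_sub_le (hD : D.WellPosed L μ σm σM) (hs : Tracks D s) (hs' : Tracks D s')
    (hP : ∀ i, ‖opr (s.P i) - opr D.Pbar‖ ≤ δ) (hP' : ∀ i, ‖opr (s'.P i) - opr D.Pbar‖ ≤ δ)
    (hδ : 0 ≤ δ) (hδM : δ ≤ σM) :
    stackNorm (fun i => s'.gy i - s.gy i) ≤ L * stackNorm (fun i => s'.y i - s.y i) +
      2 * σM * stackNorm (fun i => s'.x i - s.x i) + 2 * δ * stackNorm s.x := by
  have e : (fun i => s'.gy i - s.gy i) = fun i =>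
      (opr (s'.P i) (s'.x i - s.x i) -
        (gradient (D.h i) (s'.y i) - gradient (D.h i) (s.y i))) +
        (opr (s'.P i) - opr (s.P i)) (s.x i) := by
    funext i
    simp only [hs.gy_eq, hs'.gy_eq]
    rw [gradY_eq _ (hD.smooth_h i).1, gradY_eq _ (hD.smooth_h i).1]
    simp only [map_sub, _root_.sub_apply]
    abel
  rw [e, add_comm (L * _)]
  refine (stackNorm_add_le _ _).trans (add_le_add ((stackNorm_sub_le _ _).trans
    (add_le_add ?_ ?_)) ?_)
  · exact stackNorm_le_of_le (by linarith [hD.σM_pos]) fun i =>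
      ((opr (s'.P i)).le_opNorm _).trans (mul_le_mul_of_nonneg_right
        (norm_opr_le_two_mul hD hδM (hP' i)) (norm_nonneg _))
  · exact stackNorm_le_of_le hD.L_pos.le fun i => (hD.smooth_h i).2 _ _
  · exact stackNorm_le_of_le (by linarith) fun i =>
      ((opr (s'.P i) - opr (s.P i)).le_opNorm _).trans (mul_le_mul_of_nonneg_right
        (norm_opr_sub_le (hP i) (hP' i)) (norm_nonneg _))

variable {W : Matrix (Fin n) (Fin n) ℝ} {α β : ℝ}

lemma distX_step_le (hD : D.WellPosed L μ σm σM) (hW : W ∈ doublyStochastic ℝ (Fin n))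
    (hs : Tracks D s) (hP : ∀ i, ‖opr (s.P i) - opr D.Pbar‖ ≤ δ) (hδ : 0 ≤ δ) (hα : 0 ≤ α)
    (hαℓ : α * (L + σM * (σM / μ)) ^ 2 ≤ σm ^ 2 * μ / L ^ 2) {a : Vec px}
    (ha : D.gradPrimal a = 0) :
    distX (step D W α β s) a ≤ (1 - α * (σm ^ 2 * μ / L ^ 2) / 2) * distX s a +
      α * (L * dev s.x + σM * gapY D s + δ * stackNorm s.y) := by
  have h1 := norm_forward_sub_le hα hαℓ hD.norm_gradPrimal_sub_le hD.inner_gradPrimal_ge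
    (mean s.x) a
  rw [ha, smul_zero, sub_zero] at h1
  have h2 := sqrt_mul_norm_mean_q_sub_le hD hs hP hδ
  have e : mean (step D W α β s).x - a = (mean s.x - α • D.gradPrimal (mean s.x) - a) -
      α • (mean s.q - D.gradPrimal (mean s.x)) := by
    rw [mean_step_x hW, smul_sub]; abel
  have h3 := norm_sub_le (mean s.x - α • D.gradPrimal (mean s.x) - a)
    (α • (mean s.q - D.gradPrimal (mean s.x)))
  rw [norm_smul, Real.norm_of_nonneg hα] at h3
  have h4 := mul_le_mul_of_nonneg_left (h3.trans (add_le_add_left h1 _)) (Real.sqrt_nonneg n)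
  have h5 := mul_le_mul_of_nonneg_left h2 hα
  rw [distX, distX, e]
  linarith

lemma gapY_step_le (hD : D.WellPosed L μ σm σM) (hW : W ∈ doublyStochastic ℝ (Fin n))
    (hs : Tracks D s) (hP : ∀ i, ‖opr (s.P i) - opr D.Pbar‖ ≤ δ) (hδ : 0 ≤ δ) (hα : 0 ≤ α)
    (hβ : 0 ≤ β) (hβL : β * L ^ 2 ≤ μ) :
    gapY D (step D W α β s) ≤ (1 - β * μ / 2) * gapY D s +
      β * (L * dev s.y + δ * stackNorm s.x) + σM / μ * (α * (√n * ‖mean s.q‖)) := by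
  set A := opr D.Pbar
  set S := D.bestResponse
  set g := D.gradH (mean s.y) - A (mean s.x)
  have h1 := norm_forward_sub_le (T := fun y => D.gradH y - A (mean s.x)) hβ hβL
    (by simpa using hD.norm_gradH_sub_le) (by simpa using hD.inner_gradH_ge)
    (mean s.y) (S (A (mean s.x)))
  simp only [S, hD.gradH_bestResponse, sub_self, smul_zero, sub_zero] at h1
  have h2 := sqrt_mul_norm_mean_w_sub_le hD hs hP hδ
  have e : mean (step D W α β s).y - S (A (mean (step D W α β s).x)) =
      (mean s.y - β • g - S (A (mean s.x))) +
      β • (mean s.w - (A (mean s.x) - D.gradH (mean s.y))) +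
      (S (A (mean s.x)) - S (A (mean (step D W α β s).x))) := by
    rw [mean_step_y hW]
    simp only [g, smul_sub]
    abel
  have h3 := norm_add₃_le (a := mean s.y - β • g - S (A (mean s.x)))
    (b := β • (mean s.w - (A (mean s.x) - D.gradH (mean s.y))))
    (c := S (A (mean s.x)) - S (A (mean (step D W α β s).x)))
  have h4 := hD.norm_response_sub_le (mean s.x) (mean (step D W α β s).x)
  rw [mean_step_x hW, sub_sub_cancel, norm_smul, Real.norm_of_nonneg hα] at h4
  rw [norm_smul, Real.norm_of_nonneg hβ, mean_step_x hW] at h3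
  have h5 := mul_le_mul_of_nonneg_left (h3.trans (add_le_add (add_le_add_left h1 _) h4))
    (Real.sqrt_nonneg n)
  have h6 := mul_le_mul_of_nonneg_left h2 hβ
  rw [gapY, gapY, e, mean_step_x hW]
  linarith

lemma dev_step_x_le (hW : W ∈ doublyStochastic ℝ (Fin n)) (hα : 0 ≤ α) :
    dev (step D W α β s).x ≤ lam W * (dev s.x + α * dev s.q) :=
  (dev_mix_le hW fun r => s.x r - α • s.q r).trans
    (mul_le_mul_of_nonneg_left (dev_sub_smul_le hα _ _) (lam_nonneg W))

lemma dev_step_y_le (hW : W ∈ doublyStochastic ℝ (Fin n)) (hβ : 0 ≤ β) :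
    dev (step D W α β s).y ≤ lam W * (dev s.y + β * dev s.w) := by
  refine (dev_mix_le hW fun r => s.y r + β • s.w r).trans
    (mul_le_mul_of_nonneg_left ((dev_add_le _ _).trans ?_) (lam_nonneg W))
  rw [dev_smul, abs_of_nonneg hβ]

lemma dev_step_q_le (hn : 0 < n) (hW : W ∈ doublyStochastic ℝ (Fin n)) :
    dev (step D W α β s).q ≤
      lam W * (dev s.q + stackNorm fun i => (step D W α β s).gx i - s.gx i) := by
  rw [step_q]
  refine (dev_mix_le hW _).trans (mul_le_mul_of_nonneg_left ?_ (lam_nonneg W))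
  exact (dev_add_le _ _).trans (add_le_add le_rfl (dev_le_stackNorm hn _))

lemma dev_step_w_le (hn : 0 < n) (hW : W ∈ doublyStochastic ℝ (Fin n)) :
    dev (step D W α β s).w ≤
      lam W * (dev s.w + stackNorm fun i => (step D W α β s).gy i - s.gy i) := by
  rw [step_w]
  refine (dev_mix_le hW _).trans (mul_le_mul_of_nonneg_left ?_ (lam_nonneg W))
  exact (dev_add_le _ _).trans (add_le_add le_rfl (dev_le_stackNorm hn _))

lemma stackNorm_step_x_sub_le (hW : W ∈ doublyStochastic ℝ (Fin n)) (hl : lam W ≤ 1)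
    (hα : 0 ≤ α) : stackNorm (fun i => (step D W α β s).x i - s.x i) ≤
      2 * dev s.x + α * dev s.q + α * (√n * ‖mean s.q‖) := by
  have h1 := stackNorm_sub_le_dev (step D W α β s).x s.x
  have h2 : dev (step D W α β s).x ≤ _ := dev_step_x_le hW hα
  have h3 := mul_le_mul_of_nonneg_right hl
    (add_nonneg (dev_nonneg s.x) (mul_nonneg hα (dev_nonneg s.q)))
  rw [mean_step_x hW, sub_sub_cancel_left, norm_neg, norm_smul, Real.norm_of_nonneg hα] at h1
  linarith

lemma stackNorm_step_y_sub_le (hW : W ∈ doublyStochastic ℝ (Fin n)) (hl : lam W ≤ 1)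
    (hβ : 0 ≤ β) : stackNorm (fun i => (step D W α β s).y i - s.y i) ≤
      2 * dev s.y + β * dev s.w + β * (√n * ‖mean s.w‖) := by
  have h1 := stackNorm_sub_le_dev (step D W α β s).y s.y
  have h2 : dev (step D W α β s).y ≤ _ := dev_step_y_le hW hβ
  have h3 := mul_le_mul_of_nonneg_right hl
    (add_nonneg (dev_nonneg s.y) (mul_nonneg hβ (dev_nonneg s.w)))
  rw [mean_step_y hW, add_sub_cancel_left, norm_smul, Real.norm_of_nonneg hβ] at h1
  linarith

lemma stackNorm_x_le (s : State n px py) (a : Vec px) :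
    stackNorm s.x ≤ dev s.x + distX s a + √n * ‖a‖ := by
  have h1 := stackNorm_add_le (fun i => s.x i - a) fun _ => a
  rw [stackNorm_const] at h1
  simp only [sub_add_cancel] at h1
  have h2 := stackNorm_sub_const_le s.x a
  rw [distX]
  linarith

lemma stackNorm_y_sub_le (hD : D.WellPosed L μ σm σM) (s : State n px py) (a : Vec px) :
    stackNorm (fun i => s.y i - D.bestResponse (opr D.Pbar a)) ≤
      dev s.y + gapY D s + σM / μ * distX s a := by
  refine (stackNorm_sub_const_le _ _).trans ?_
  have h1 := norm_sub_le_norm_sub_add_norm_sub (mean s.y)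
    (D.bestResponse (opr D.Pbar (mean s.x))) (D.bestResponse (opr D.Pbar a))
  have h2 := mul_le_mul_of_nonneg_left (h1.trans (add_le_add le_rfl
    (hD.norm_response_sub_le (mean s.x) a))) (Real.sqrt_nonneg n)
  rw [gapY, distX]
  linarith

lemma stackNorm_y_le (hD : D.WellPosed L μ σm σM) (s : State n px py) (a : Vec px) :
    stackNorm s.y ≤ dev s.y + gapY D s + σM / μ * distX s a +
      √n * ‖D.bestResponse (opr D.Pbar a)‖ := by
  have h1 := stackNorm_add_le (fun i => s.y i - D.bestResponse (opr D.Pbar a))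
    fun _ => D.bestResponse (opr D.Pbar a)
  rw [stackNorm_const] at h1
  simp only [sub_add_cancel] at h1
  linarith [stackNorm_y_sub_le hD s a]

lemma err_le (hD : D.WellPosed L μ σm σM) (s : State n px py) (a : Vec px) :
    err s a (D.bestResponse (opr D.Pbar a)) ≤
      (dev s.x + distX s a) + (dev s.y + gapY D s + σM / μ * distX s a) :=
  add_le_add (stackNorm_sub_const_le s.x a) (stackNorm_y_sub_le hD s a)

end Step

/-! ### The Lyapunov function -/

section Lyapunov

/-- Weights `A, cb, cX, cY, cQ, 1` for the six error components (distance of `x̄`, gap of `ȳ`,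
consensus errors of `x`, `y` and of the trackers `q`, `w`) under which every column of the matrix
of the error recursion loses the factor `1 - α m / 4`. Here `σ` bounds the coupling, `ℓ` and `m`
are the smoothness and strong convexity constants of the primal function, `l` is the consensus
rate. -/
structure Weights (L μ σ ℓ m l α β A cb cX cY cQ : ℝ) : Prop where
  A_pos : 0 < A
  cb_pos : 0 < cb
  cX_pos : 0 < cX
  cY_pos : 0 < cY
  cQ_pos : 0 < cQ
  col_a : cb * (σ / μ) * ℓ + (cQ * L + 2 * σ) * ℓ ≤ A * m / 4
  col_b : α * (A * σ + cb * (σ / μ) * σ + (cQ * L + 2 * σ) * σ) + (2 * σ * cQ + L) * β * L ≤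
    cb * (β * μ / 2 - α * m / 4)
  col_X : α * (A * L + cb * (σ / μ) * L + (cQ * L + 2 * σ) * L) + 2 * (cQ * L + 2 * σ) ≤
    cX * (1 - l - α * m / 4)
  col_Y : cb * β * L + (2 * σ * cQ + L) * (2 + β * L) ≤ cY * (1 - l - α * m / 4)
  col_Q : α * (cX + (cQ * L + 2 * σ)) ≤ cQ * (1 - l - α * m / 4)
  col_W : β * (cY + (2 * σ * cQ + L)) ≤ 1 - l - α * m / 4

/-- The error recursion contracts the weighted sum of the error components. -/
lemma lyapunov_le {L μ σ ℓ m l α β A cb cX cY cQ : ℝ}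
    (w : Weights L μ σ ℓ m l α β A cb cX cY cQ) (hL : 0 ≤ L) (hσ : 0 ≤ σ)
    (hl1 : l ≤ 1) (hα : 0 ≤ α) (hβ : 0 ≤ β)
    {a b X Y Q V D a' b' X' Y' Q' V' dx dy : ℝ} (ha0 : 0 ≤ a) (hb0 : 0 ≤ b) (hX0 : 0 ≤ X)
    (hY0 : 0 ≤ Y) (hQ0 : 0 ≤ Q) (hV0 : 0 ≤ V) (hD0 : 0 ≤ D) (hdx0 : 0 ≤ dx) (hdy0 : 0 ≤ dy)
    (ha : a' ≤ (1 - α * m / 2) * a + α * (L * X + σ * b + D))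
    (hb : b' ≤ (1 - β * μ / 2) * b + β * (L * Y + D) +
      σ / μ * (α * (ℓ * a + (L * X + σ * b + D))))
    (hX : X' ≤ l * (X + α * Q)) (hY : Y' ≤ l * (Y + β * V))
    (hQ : Q' ≤ l * (Q + (L * dx + 2 * σ * dy + 2 * D)))
    (hV : V' ≤ l * (V + (L * dy + 2 * σ * dx + 2 * D)))
    (hdx : dx ≤ 2 * X + α * Q + α * (ℓ * a + (L * X + σ * b + D)))
    (hdy : dy ≤ 2 * Y + β * V + β * (L * b + (L * Y + D))) :
    A * a' + cb * b' + cX * X' + cY * Y' + cQ * Q' + V' ≤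
      (1 - α * m / 4) * (A * a + cb * b + cX * X + cY * Y + cQ * Q + V) +
      (A * α + cb * β + cb * (σ / μ) * α + (cQ * L + 2 * σ) * α + (2 * σ * cQ + L) * β +
        2 * cQ + 2) * D := by
  have hA := w.A_pos.le
  have hcb := w.cb_pos.le
  have hcX := w.cX_pos.le
  have hcY := w.cY_pos.le
  have hcQ := w.cQ_pos.le
  -- the factor `l` is only kept on the diagonal entries of the consensus rows
  have hX1 : X' ≤ l * X + α * Q := by nlinarith [mul_nonneg hα hQ0]
  have hY1 : Y' ≤ l * Y + β * V := by nlinarith [mul_nonneg hβ hV0]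
  have hQ1 : Q' ≤ l * Q + (L * dx + 2 * σ * dy + 2 * D) := by
    have : 0 ≤ L * dx + 2 * σ * dy + 2 * D := by positivity
    nlinarith
  have hV1 : V' ≤ l * V + (L * dy + 2 * σ * dx + 2 * D) := by
    have : 0 ≤ L * dy + 2 * σ * dx + 2 * D := by positivity
    nlinarith
  have r1 := mul_le_mul_of_nonneg_left ha hA
  have r2 := mul_le_mul_of_nonneg_left hb hcb
  have r3 := mul_le_mul_of_nonneg_left hX1 hcX
  have r4 := mul_le_mul_of_nonneg_left hY1 hcY
  have r5 := mul_le_mul_of_nonneg_left hQ1 hcQ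
  have r6 := mul_le_mul_of_nonneg_left hdx (show 0 ≤ cQ * L + 2 * σ by positivity)
  have r7 := mul_le_mul_of_nonneg_left hdy (show 0 ≤ 2 * σ * cQ + L by positivity)
  have k1 := mul_le_mul_of_nonneg_right w.col_a (mul_nonneg hα ha0)
  have k2 := mul_le_mul_of_nonneg_right w.col_b hb0
  have k3 := mul_le_mul_of_nonneg_right w.col_X hX0
  have k4 := mul_le_mul_of_nonneg_right w.col_Y hY0
  have k5 := mul_le_mul_of_nonneg_right w.col_Q hQ0
  have k6 := mul_le_mul_of_nonneg_right w.col_W hV0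
  linarith

/-- For a fixed admissible `β`, weights exist once `α` is small enough: at `α = 0` the error
recursion splits into the ascent by gradient tracking, for which `β` is admissible, and the
consensus in `x`; the strict inequalities left there absorb the terms of order `α`. -/
lemma exists_weights {L μ σ ℓ m l β : ℝ} (hL : 0 < L) (hμ : 0 < μ) (hσ : 0 < σ) (hℓ : 0 < ℓ)
    (hm : 0 < m) (hl1 : l < 1) (hβ : 0 < β) (hβl : 192 * (β * L) ≤ (1 - l) ^ 2)
    (hβμ : 382 * (β * L ^ 2) ≤ μ) (hl0 : 0 ≤ l) :
    ∃ A cb cX cY cQ, ∀ᶠ α in nhdsWithin (0 : ℝ) (Set.Ioi 0),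
      Weights L μ σ ℓ m l α β A cb cX cY cQ ∧ α * ℓ ^ 2 ≤ m ∧ α * m / 4 ≤ 1 - l := by
  have h1l : 0 < 1 - l := by linarith
  have hev (K P : ℝ) (hP : 0 < P) : ∀ᶠ α in nhdsWithin (0 : ℝ) (Set.Ioi 0), α * K ≤ P := by
    have hc : Filter.Tendsto (fun α : ℝ => α * K) (nhdsWithin 0 (Set.Ioi 0)) (nhds 0) := by
      have : Filter.Tendsto (fun α : ℝ => α * K) (nhds 0) (nhds (0 * K)) :=
        Filter.tendsto_id.mul_const K
      rw [zero_mul] at this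
      exact this.mono_left nhdsWithin_le_nhds
    exact hc.eventually (ge_mem_nhds hP)
  obtain ⟨cQ, hcQ⟩ : ∃ cQ, cQ = L / (8 * σ) := ⟨_, rfl⟩
  obtain ⟨cb, hcb⟩ : ∃ cb, cb = 8 * L ^ 2 / μ := ⟨_, rfl⟩
  obtain ⟨ex, hex⟩ : ∃ ex, ex = cQ * L + 2 * σ := ⟨_, rfl⟩
  obtain ⟨A, hA⟩ : ∃ A, A = 4 * (cb * (σ / μ) * ℓ + ex * ℓ) / m := ⟨_, rfl⟩
  obtain ⟨cX, hcX⟩ : ∃ cX, cX = 4 * ex / (1 - l) := ⟨_, rfl⟩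
  obtain ⟨cY, hcY⟩ : ∃ cY, cY = 2 * (cb * β * L + 4 * L) / (1 - l) := ⟨_, rfl⟩
  have hcQ0 : 0 < cQ := by rw [hcQ]; positivity
  have hcb0 : 0 < cb := by rw [hcb]; positivity
  have hex0 : 0 < ex := by rw [hex]; positivity
  have hA0 : 0 < A := by rw [hA]; positivity
  have hcX0 : 0 < cX := by rw [hcX]; positivity
  have hcY0 : 0 < cY := by rw [hcY]; positivity
  have hey : 2 * σ * cQ + L = 5 / 4 * L := by rw [hcQ]; field_simp; ring
  have hcbμ : cb * (β * μ / 2) = 4 * (β * L ^ 2) := by rw [hcb]; field_simp; ring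
  have hA' : A * m / 4 = cb * (σ / μ) * ℓ + ex * ℓ := by rw [hA]; field_simp
  have hcX' : cX * (1 - l) = 4 * ex := by rw [hcX]; field_simp
  have hcY' : cY * (1 - l) = 2 * (cb * β * L + 4 * L) := by rw [hcY]; field_simp
  have hβL : β * L ≤ 1 / 192 := by nlinarith
  have hβL0 : 0 < β * L := by positivity
  have hcbβ : cb * β ≤ 8 / 382 := by
    have : cb * β = 8 * (β * L ^ 2) / μ := by rw [hcb]; ring
    rw [this, div_le_iff₀ hμ]
    linarith
  have hW : β * (cY + (2 * σ * cQ + L)) ≤ (1 - l) / 2 := by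
    rw [hey]
    have h1 : (β * cY) * (1 - l) ≤ (1 - l) / 4 * (1 - l) := by
      have : (β * cY) * (1 - l) = 2 * (cb * β + 4) * (β * L) := by
        rw [mul_assoc, hcY']; ring
      rw [this]
      nlinarith
    have h2 : β * cY ≤ (1 - l) / 4 := le_of_mul_le_mul_right h1 h1l
    nlinarith
  refine ⟨A, cb, cX, cY, cQ, ?_⟩
  filter_upwards [hev (A * σ + cb * (σ / μ) * σ + ex * σ + cb * (m / 4)) (β * L ^ 2)
      (by positivity),
    hev (A * L + cb * (σ / μ) * L + ex * L + cX * (m / 4)) ex hex0,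
    hev (cY * (m / 4)) L hL, hev (cX + ex + cQ * (m / 4)) (cQ * (1 - l)) (by positivity),
    hev (m / 4) ((1 - l) / 2) (by positivity), hev (ℓ ^ 2) m hm]
    with α h1 h2 h3 h4 h5 h6
  refine ⟨⟨hA0, hcb0, hcX0, hcY0, hcQ0, ?_, ?_, ?_, ?_, ?_, ?_⟩, h6, ?_⟩
  · rw [← hex, hA']
  · rw [← hex, hey, mul_sub, hcbμ]
    have : 0 < β * L ^ 2 := by positivity
    linarith
  · rw [← hex, mul_sub, hcX']
    linarith
  · rw [hey, mul_sub, hcY']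
    have h7 : 0 < cb * β * L := by positivity
    nlinarith
  · rw [← hex, mul_sub]
    linarith
  · linarith
  · linarith

end Lyapunov

/-! ### Linear convergence of the iteration -/

section Convergence

variable {n px py : ℕ}

/-- The weighted sum of the six error components. -/
noncomputable def energy (D : Problem n px py) (A cb cX cY cQ : ℝ) (a : Vec px)
    (s : State n px py) : ℝ :=
  A * distX s a + cb * gapY D s + cX * dev s.x + cY * dev s.y + cQ * dev s.q + dev s.w

variable {D : Problem n px py} {L μ σm σM : ℝ} {W : Matrix (Fin n) (Fin n) ℝ}
  {α β A cb cX cY cQ : ℝ}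

lemma energy_step_le (hD : D.WellPosed L μ σm σM) (hW : W ∈ doublyStochastic ℝ (Fin n))
    (hl : lam W ≤ 1) (hα : 0 ≤ α) (hβ : 0 ≤ β)
    (w : Weights L μ σM (L + σM * (σM / μ)) (σm ^ 2 * μ / L ^ 2) (lam W) α β A cb cX cY cQ)
    (hαℓ : α * (L + σM * (σM / μ)) ^ 2 ≤ σm ^ 2 * μ / L ^ 2) (hβL : β * L ^ 2 ≤ μ)
    {a : Vec px} (ha : D.gradPrimal a = 0) {s : State n px py} (hs : Tracks D s) {δ : ℝ}
    (hP : ∀ i, ‖opr (s.P i) - opr D.Pbar‖ ≤ δ)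
    (hP' : ∀ i, ‖opr ((step D W α β s).P i) - opr D.Pbar‖ ≤ δ) (hδ : 0 ≤ δ) (hδM : δ ≤ σM) :
    energy D A cb cX cY cQ a (step D W α β s) ≤
      (1 - α * (σm ^ 2 * μ / L ^ 2) / 4) * energy D A cb cX cY cQ a s +
      (A * α + cb * β + cb * (σM / μ) * α + (cQ * L + 2 * σM) * α + (2 * σM * cQ + L) * β +
        2 * cQ + 2) * (δ * (stackNorm s.x + stackNorm s.y)) := by
  have hx0 := mul_nonneg hδ (stackNorm_nonneg s.x)
  have hy0 := mul_nonneg hδ (stackNorm_nonneg s.y)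
  have hL := hD.L_pos.le
  have hσ := hD.σM_pos.le
  have hs' : Tracks D (step D W α β s) := hs.step hW
  have hlam := lam_nonneg W
  have hsμ : 0 ≤ σM / μ := div_nonneg hσ hD.μ_pos.le
  have hq := sqrt_mul_norm_mean_q_le hD hs hP hδ ha
  have hw := sqrt_mul_norm_mean_w_le hD hs hP hδ
  have e : δ * (stackNorm s.x + stackNorm s.y) = δ * stackNorm s.x + δ * stackNorm s.y :=
    mul_add _ _ _
  set N := δ * (stackNorm s.x + stackNorm s.y)
  refine lyapunov_le w hL hσ hl hα hβ (distX_nonneg s a) (gapY_nonneg s) (dev_nonneg _)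
    (dev_nonneg _) (dev_nonneg _) (dev_nonneg _) (by linarith)
    (stackNorm_nonneg fun i => (step D W α β s).x i - s.x i)
    (stackNorm_nonneg fun i => (step D W α β s).y i - s.y i)
    ((distX_step_le hD hW hs hP hδ hα hαℓ ha).trans ?_)
    ((gapY_step_le hD hW hs hP hδ hα hβ hβL).trans ?_)
    (dev_step_x_le hW hα) (dev_step_y_le hW hβ)
    ((dev_step_q_le hD.n_pos hW).trans (mul_le_mul_of_nonneg_left (add_le_add le_rfl
      ((stackNorm_gx_sub_le hD hs hs' hP hP' hδ hδM).trans ?_)) hlam))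
    ((dev_step_w_le hD.n_pos hW).trans (mul_le_mul_of_nonneg_left (add_le_add le_rfl
      ((stackNorm_gy_sub_le hD hs hs' hP hP' hδ hδM).trans ?_)) hlam))
    ((stackNorm_step_x_sub_le hW hl hα).trans ?_)
    ((stackNorm_step_y_sub_le hW hl hβ).trans ?_)
  · gcongr; linarith
  · gcongr
    · linarith
    · linarith
  · linarith
  · linarith
  · gcongr; linarith
  · gcongr; linarith

/-- The iterates converge linearly to the saddle point. The heterogeneity of the coupling matrices
only enters as a perturbation that decays like `lam W ^ k`. -/
lemma exists_err_run_le (hD : D.WellPosed L μ σm σM) (hW : W ∈ doublyStochastic ℝ (Fin n))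
    (hl : lam W < 1) (hα : 0 < α) (hβ : 0 ≤ β)
    (w : Weights L μ σM (L + σM * (σM / μ)) (σm ^ 2 * μ / L ^ 2) (lam W) α β A cb cX cY cQ)
    (hαℓ : α * (L + σM * (σM / μ)) ^ 2 ≤ σm ^ 2 * μ / L ^ 2) (hβL : β * L ^ 2 ≤ μ)
    (hθ : α * (σm ^ 2 * μ / L ^ 2) / 4 ≤ 1 - lam W)
    {a : Vec px} (ha : D.gradPrimal a = 0) (x0 : Fin n → Vec px) (y0 : Fin n → Vec py) :
    ∃ ψ, 0 < ψ ∧ ∀ k, err (run D W α β x0 y0 k) a (D.bestResponse (opr D.Pbar a)) ≤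
      ψ * (1 - α * (σm ^ 2 * μ / L ^ 2) / 4 / 2) ^ k := by
  have hA := w.A_pos
  have hcb := w.cb_pos
  have hcX := w.cX_pos
  have hcY := w.cY_pos
  have hcQ := w.cQ_pos
  have hL := hD.L_pos
  have hσ := hD.σM_pos
  have hμ := hD.μ_pos
  have hlam := lam_nonneg W
  have hm := hD.modulus_pos
  set θ := α * (σm ^ 2 * μ / L ^ 2) / 4 with hθdef
  have hθ0 : 0 < θ := by rw [hθdef]; positivity
  set V : ℕ → ℝ := fun k => energy D A cb cX cY cQ a (run D W α β x0 y0 k) with hVdef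
  have hV0 (k : ℕ) : 0 ≤ V k := by
    have h1 := distX_nonneg (run D W α β x0 y0 k) a
    have h2 := gapY_nonneg (D := D) (run D W α β x0 y0 k)
    have h3 := dev_nonneg (run D W α β x0 y0 k).x
    have h4 := dev_nonneg (run D W α β x0 y0 k).y
    have h5 := dev_nonneg (run D W α β x0 y0 k).q
    have h6 := dev_nonneg (run D W α β x0 y0 k).w
    simp only [hVdef, energy]
    positivity
  set κ₁ := 1 / cX + (1 + σM / μ) / A + 1 / cY + 1 / cb with hκ₁
  have hκ₁0 : 0 < κ₁ := by rw [hκ₁]; positivity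
  have hcomp (k : ℕ) : (dev (run D W α β x0 y0 k).x + distX (run D W α β x0 y0 k) a) +
      (dev (run D W α β x0 y0 k).y + gapY D (run D W α β x0 y0 k) +
        σM / μ * distX (run D W α β x0 y0 k) a) ≤ κ₁ * V k := by
    have h1 := distX_nonneg (run D W α β x0 y0 k) a
    have h2 := gapY_nonneg (D := D) (run D W α β x0 y0 k)
    have h3 := dev_nonneg (run D W α β x0 y0 k).x
    have h4 := dev_nonneg (run D W α β x0 y0 k).y
    have h5 := dev_nonneg (run D W α β x0 y0 k).q
    have h6 := dev_nonneg (run D W α β x0 y0 k).w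
    have hVk : V k = energy D A cb cX cY cQ a (run D W α β x0 y0 k) := rfl
    rw [energy] at hVk
    generalize distX (run D W α β x0 y0 k) a = da at *
    generalize gapY D (run D W α β x0 y0 k) = db at *
    generalize dev (run D W α β x0 y0 k).x = dx at *
    generalize dev (run D W α β x0 y0 k).y = dy at *
    generalize dev (run D W α β x0 y0 k).q = dq at *
    generalize dev (run D W α β x0 y0 k).w = dw at *
    have p1 := mul_nonneg hA.le h1
    have p2 := mul_nonneg hcb.le h2
    have p3 := mul_nonneg hcX.le h3
    have p4 := mul_nonneg hcY.le h4
    have p5 := mul_nonneg hcQ.le h5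
    have q1 : (1 + σM / μ) * da ≤ (1 + σM / μ) / A * V k := by
      rw [div_mul_eq_mul_div, le_div_iff₀ hA, mul_assoc]
      exact mul_le_mul_of_nonneg_left (by linarith) (by positivity)
    have q2 : db ≤ 1 / cb * V k := by
      rw [div_mul_eq_mul_div, le_div_iff₀ hcb]; linarith
    have q3 : dx ≤ 1 / cX * V k := by
      rw [div_mul_eq_mul_div, le_div_iff₀ hcX]; linarith
    have q4 : dy ≤ 1 / cY * V k := by
      rw [div_mul_eq_mul_div, le_div_iff₀ hcY]; linarith
    rw [hκ₁]
    linarith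
  set K₀ := ∑ r, ‖opr (D.P r)‖
  have hK₀ : 0 ≤ K₀ := sum_nonneg fun r _ => norm_nonneg _
  set c₁ := √n * ‖a‖ + √n * ‖D.bestResponse (opr D.Pbar a)‖
  have hc₁ : 0 ≤ c₁ := by positivity
  set K₂ := A * α + cb * β + cb * (σM / μ) * α + (cQ * L + 2 * σM) * α +
    (2 * σM * cQ + L) * β + 2 * cQ + 2
  have hK₂ : 0 ≤ K₂ := by positivity
  -- from here on the coupling matrices are within `σM` of their average
  have hlim : Filter.Tendsto (fun k => K₀ * lam W ^ k) Filter.atTop (nhds 0) := by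
    simpa using (tendsto_pow_atTop_nhds_zero_of_lt_one hlam hl).const_mul K₀
  obtain ⟨k₀, hk₀⟩ := Filter.eventually_atTop.mp (hlim.eventually (ge_mem_nhds hσ))
  obtain ⟨ψ, hψ, hle⟩ := exists_le_mul_pow (V := V) (K := K₂ * (K₀ * (κ₁ + c₁))) (k₀ := k₀)
    hθ0 (by linarith) hlam (by linarith) (by positivity) hV0 (fun k hk => by
      have hP := norm_opr_run_P_sub_le (D := D) (α := α) (β := β) hD.n_pos hW x0 y0 k
      have hP' := norm_opr_run_P_sub_le (D := D) (α := α) (β := β) hD.n_pos hW x0 y0 (k + 1)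
      have hmono : K₀ * lam W ^ (k + 1) ≤ K₀ * lam W ^ k :=
        mul_le_mul_of_nonneg_left (pow_le_pow_of_le_one hlam hl.le (Nat.le_succ k)) hK₀
      rw [run_succ] at hP'
      have hstep := energy_step_le hD hW hl.le hα.le hβ w hαℓ hβL ha
        (tracks_run hW x0 y0 k) hP (fun i => (hP' i).trans hmono)
        (by positivity) (hk₀ k hk)
      have hnorm : stackNorm (run D W α β x0 y0 k).x + stackNorm (run D W α β x0 y0 k).y ≤
          (κ₁ + c₁) * (V k + 1) := by
        have h1 := stackNorm_x_le (run D W α β x0 y0 k) a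
        have h2 := stackNorm_y_le hD (run D W α β x0 y0 k) a
        have h3 := hcomp k
        have h4 := mul_nonneg hc₁ (hV0 k)
        linarith
      have hfin := mul_le_mul_of_nonneg_left (mul_le_mul_of_nonneg_left hnorm
        (show 0 ≤ K₀ * lam W ^ k by positivity)) hK₂
      rw [← run_succ] at hstep
      refine (hstep.trans (add_le_add le_rfl hfin)).trans (le_of_eq ?_)
      simp only [hVdef]
      ring)
  refine ⟨κ₁ * ψ, by positivity, fun k => ?_⟩
  rw [mul_assoc]
  exact ((err_le hD _ a).trans (hcomp k)).trans (mul_le_mul_of_nonneg_left (hle k) hκ₁0.le)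

end Convergence

/-! ### Stepsizes and rate -/

section Rate

variable {L μ σm σM l : ℝ}

lemma betaBar_pos (hL : 0 < L) (hμ : 0 < μ) (hσm : 0 < σm) (hσM : 0 < σM) (hl : l < 1) :
    0 < betaBar L μ σm σM l := by
  have : 0 < 1 - l := by linarith
  unfold betaBar
  positivity

lemma betaBar_mul_le (hL : 0 < L) (hσm : 0 < σm) (hσ : σm ≤ σM) :
    192 * (betaBar L μ σm σM l * L) ≤ (1 - l) ^ 2 := by
  have hσM : 0 < σM := hσm.trans_le hσ
  have h1 : betaBar L μ σm σM l ≤ σm ^ 2 * (1 - l) ^ 2 / (192 * σM ^ 2 * L) :=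
    (min_le_left _ _).trans (min_le_left _ _)
  rw [le_div_iff₀ (by positivity)] at h1
  have h2 := mul_le_mul_of_nonneg_right (pow_le_pow_left₀ hσm.le hσ 2) (sq_nonneg (1 - l))
  have h3 : 192 * (betaBar L μ σm σM l * L) * σM ^ 2 ≤ (1 - l) ^ 2 * σM ^ 2 := by linarith
  exact le_of_mul_le_mul_right h3 (by positivity)

lemma betaBar_mul_sq_le (hL : 0 < L) (hμ : 0 < μ) :
    382 * (betaBar L μ σm σM l * L ^ 2) ≤ μ := by
  have h1 : betaBar L μ σm σM l ≤ 1 / (382 * (L / μ) * L) := min_le_right _ _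
  rw [le_div_iff₀ (by positivity)] at h1
  have h2 : betaBar L μ σm σM l * (382 * (L / μ) * L) =
      382 * (betaBar L μ σm σM l * L ^ 2) / μ := by field_simp
  rwa [h2, div_le_one hμ] at h1

/-- The scale `σ_M² L² / (σ_m² μ³ β̄)` of the convergence time is at most `382 R`. Where the second
entry of `β̄` is active, `R` is compared with the geometric mean of its first two entries. -/
lemma le_rate_mul_betaBar (hμ : 0 < μ) (hσm : 0 < σm) (hσ : σm ≤ σM) (hμL : μ ≤ L)
    (hl0 : 0 ≤ l) (hl : l < 1) :
    σM ^ 2 * L ^ 2 / (σm ^ 2 * μ ^ 3) ≤ 382 * (rate L μ σm σM l * betaBar L μ σm σM l) := by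
  have hσM : 0 < σM := hσm.trans_le hσ
  have hL : 0 < L := hμ.trans_le hμL
  have ht0 : 0 < 1 - l := by linarith
  have ht1 : 1 - l ≤ 1 := by linarith
  obtain ⟨t, ht⟩ : ∃ t, t = 1 - l := ⟨_, rfl⟩
  obtain ⟨R, hR⟩ : ∃ R, R = rate L μ σm σM l := ⟨_, rfl⟩
  obtain ⟨γ, hγ⟩ : ∃ γ, γ = σM / σm := ⟨_, rfl⟩
  obtain ⟨κ, hκ⟩ : ∃ κ, κ = L / μ := ⟨_, rfl⟩
  rw [← ht] at ht0 ht1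
  have hγ1 : 1 ≤ γ := by rw [hγ, le_div_iff₀ hσm]; linarith
  have hκ1 : 1 ≤ κ := by rw [hκ, le_div_iff₀ hμ]; linarith
  have hγ0 : 0 < γ := by linarith
  have hκ0 : 0 < κ := by linarith
  have hσM' : σM = γ * σm := by rw [hγ]; field_simp
  have hL' : L = κ * μ := by rw [hκ]; field_simp
  have R1 : γ ^ 6 * κ ^ 3 / t ^ 4 ≤ R := by
    rw [hR, hγ, hκ, ht]; exact (le_max_left _ _).trans (le_max_left _ _)
  have R2 : σm ^ 2 * σM ^ 2 * κ / (L ^ 2 * μ ^ 2 * t ^ 4) ≤ R := by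
    rw [hR, hκ, ht]; exact (le_max_right _ _).trans (le_max_left _ _)
  have R3 : γ ^ 2 * κ ^ 5 ≤ R := by rw [hR, hγ, hκ]; exact le_max_right _ _
  have hR0 : 0 < R := lt_of_lt_of_le (by positivity) R3
  have hgoal : σM ^ 2 * L ^ 2 / (σm ^ 2 * μ ^ 3) = γ ^ 2 * κ ^ 2 / μ := by
    rw [hσM', hL']; field_simp
  rw [hgoal, ← hR, betaBar, ← ht]
  have ht4 : t ^ 4 ≤ t ^ 2 := pow_le_pow_of_le_one ht0.le ht1 (by norm_num)
  rcases min_choice (min (σm ^ 2 * t ^ 2 / (192 * σM ^ 2 * L)) (L * t ^ 2 / (48 * σM ^ 2)))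
    (1 / (382 * (L / μ) * L)) with h | h <;> rw [h]
  · rcases min_choice (σm ^ 2 * t ^ 2 / (192 * σM ^ 2 * L)) (L * t ^ 2 / (48 * σM ^ 2))
      with h | h <;> rw [h]
    · have h1 := mul_le_mul_of_nonneg_right R1
        (show 0 ≤ σm ^ 2 * t ^ 2 / (192 * σM ^ 2 * L) by positivity)
      have e : γ ^ 6 * κ ^ 3 / t ^ 4 * (σm ^ 2 * t ^ 2 / (192 * σM ^ 2 * L)) =
          γ ^ 2 * κ ^ 2 / μ * (γ ^ 2 / (192 * t ^ 2)) := by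
        rw [hσM', hL']; field_simp
      have h2 : 1 / 192 ≤ γ ^ 2 / (192 * t ^ 2) := by
        rw [div_le_div_iff₀ (by norm_num) (by positivity)]
        nlinarith
      have h3 := mul_le_mul_of_nonneg_left h2
        (show 0 ≤ γ ^ 2 * κ ^ 2 / μ by positivity)
      rw [e] at h1
      have h4 : 0 ≤ γ ^ 2 * κ ^ 2 / μ := by positivity
      linarith
    · -- `γ² κ² σ_M² / (L μ t⁴)` is the geometric mean of the first two entries of `R`
      have hgm : γ ^ 2 * κ ^ 2 * σM ^ 2 / (L * μ * t ^ 4) ≤ R := by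
        refine (sq_le_sq₀ (by positivity) hR0.le).mp ?_
        have e : (γ ^ 2 * κ ^ 2 * σM ^ 2 / (L * μ * t ^ 4)) ^ 2 =
            (γ ^ 6 * κ ^ 3 / t ^ 4) *
              (σm ^ 2 * σM ^ 2 * κ / (L ^ 2 * μ ^ 2 * t ^ 4)) := by
          rw [hσM']; field_simp
        rw [e, pow_two R]
        exact mul_le_mul R1 R2 (by positivity) hR0.le
      have h1 := mul_le_mul_of_nonneg_right hgm
        (show 0 ≤ L * t ^ 2 / (48 * σM ^ 2) by positivity)
      have e : γ ^ 2 * κ ^ 2 * σM ^ 2 / (L * μ * t ^ 4) * (L * t ^ 2 / (48 * σM ^ 2)) =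
          γ ^ 2 * κ ^ 2 / μ * (1 / (48 * t ^ 2)) := by field_simp
      have h2 : (1 : ℝ) / 48 ≤ 1 / (48 * t ^ 2) := by
        rw [div_le_div_iff₀ (by norm_num) (by positivity)]
        nlinarith
      have h3 := mul_le_mul_of_nonneg_left h2
        (show 0 ≤ γ ^ 2 * κ ^ 2 / μ by positivity)
      rw [e] at h1
      have h4 : 0 ≤ γ ^ 2 * κ ^ 2 / μ := by positivity
      linarith
  · have h1 := mul_le_mul_of_nonneg_right R3
      (show 0 ≤ 1 / (382 * (L / μ) * L) by positivity)
    have e : γ ^ 2 * κ ^ 5 * (1 / (382 * (L / μ) * L)) =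
        γ ^ 2 * κ ^ 2 / μ * (κ / 382) := by
      rw [hL']; field_simp
    have h3 := mul_le_mul_of_nonneg_left hκ1
      (show 0 ≤ γ ^ 2 * κ ^ 2 / μ by positivity)
    rw [e] at h1
    linarith

/-- The contraction margin of the iteration is at least a universal multiple of `1 / (c R)`. -/
lemma one_le_rate_mul_margin {c : ℝ} (hμ : 0 < μ) (hσm : 0 < σm) (hσ : σm ≤ σM) (hμL : μ ≤ L)
    (hl0 : 0 ≤ l) (hl : l < 1) (hc : 0 < c) :
    1 ≤ 1528 * c * rate L μ σm σM l *
      (alphaBar c L μ σm σM l * (σm ^ 2 * μ / L ^ 2) / 4) := by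
  have hσM : 0 < σM := hσm.trans_le hσ
  have hL : 0 < L := hμ.trans_le hμL
  have h := le_rate_mul_betaBar hμ hσm hσ hμL hl0 hl
  have hp : 0 < σm ^ 2 * μ ^ 3 / (σM ^ 2 * L ^ 2) := by positivity
  have h2 := mul_le_mul_of_nonneg_right h hp.le
  have e1 : σM ^ 2 * L ^ 2 / (σm ^ 2 * μ ^ 3) * (σm ^ 2 * μ ^ 3 / (σM ^ 2 * L ^ 2)) = 1 := by
    field_simp
  rw [e1] at h2
  refine h2.trans (le_of_eq ?_)
  rw [alphaBar]
  field_simp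
  ring

/-- Iteration count for a linearly convergent sequence: a total of `2 (K + 1)` evaluations up to
iteration `K` is of order `log (1 / ε) / θ`. The count `(4 / θ) log (1 / ε)` is twice what the rate
asks for, and the spare factor `ε` absorbs `ψ`. -/
lemma exists_iteration_bound {e : ℕ → ℝ} {ψ θ : ℝ} (hψ : 0 < ψ) (hθ : 0 < θ) (hθ1 : θ ≤ 1)
    (he : ∀ k, e k ≤ ψ * (1 - θ / 2) ^ k) :
    ∃ ε₀ : ℝ, 0 < ε₀ ∧ ∀ ε, 0 < ε → ε ≤ ε₀ → ∃ K : ℕ,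
      (2 * (K + 1) : ℝ) ≤ 12 / θ * Real.log (1 / ε) ∧ ∀ k, K ≤ k → e k ≤ ε := by
  refine ⟨min (1 / ψ) (Real.exp (-1)), by positivity, fun ε hε hεle => ?_⟩
  have h1 : ε * ψ ≤ 1 := by
    rw [← le_div_iff₀ hψ]; exact hεle.trans (min_le_left _ _)
  have hlog : 1 ≤ Real.log (1 / ε) := by
    rw [one_div, Real.log_inv]
    have := Real.log_le_log hε (hεle.trans (min_le_right _ _))
    rw [Real.log_exp] at this
    linarith
  refine ⟨⌈4 / θ * Real.log (1 / ε)⌉₊, ?_, fun k hk => ?_⟩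
  · have h2 := (Nat.ceil_lt_add_one (show 0 ≤ 4 / θ * Real.log (1 / ε) by positivity)).le
    have h3 : 1 ≤ 1 / θ := by rw [le_div_iff₀ hθ]; linarith
    have h4 : Real.log (1 / ε) ≤ 1 / θ * Real.log (1 / ε) :=
      le_mul_of_one_le_left (by linarith) h3
    have h5 : 4 / θ * Real.log (1 / ε) = 4 * (1 / θ * Real.log (1 / ε)) := by ring
    have h6 : 12 / θ * Real.log (1 / ε) = 12 * (1 / θ * Real.log (1 / ε)) := by ring
    rw [h5] at h2 ⊢
    rw [h6]
    linarith
  · have h2 : 4 / θ * Real.log (1 / ε) ≤ k := (Nat.le_ceil _).trans (by exact_mod_cast hk)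
    rw [div_mul_eq_mul_div, div_le_iff₀ hθ] at h2
    have h3 : 1 - θ / 2 ≤ Real.exp (-(θ / 2)) := by
      linarith [Real.add_one_le_exp (-(θ / 2))]
    have h4 : (1 - θ / 2) ^ k ≤ ε ^ 2 := by
      refine (pow_le_pow_left₀ (by linarith) h3 k).trans ?_
      rw [← Real.exp_nat_mul]
      calc Real.exp (k * -(θ / 2)) ≤ Real.exp (2 * Real.log ε) := by
            rw [one_div, Real.log_inv] at h2
            exact Real.exp_le_exp.mpr (by linarith)
        _ = ε ^ 2 := by rw [mul_comm, Real.exp_mul, Real.exp_log hε]; norm_num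
    calc e k ≤ ψ * (1 - θ / 2) ^ k := he k
      _ ≤ ψ * ε ^ 2 := mul_le_mul_of_nonneg_left h4 hψ.le
      _ = ε * ψ * ε := by ring
      _ ≤ 1 * ε := mul_le_mul_of_nonneg_right h1 hε.le
      _ = ε := one_mul ε

/-- Above a threshold for `c` that depends on the problem constants only, `ᾱ` is so small compared
with `β̄` that weights for the Lyapunov function exist. The threshold is taken outside the
hypotheses, so that it can be chosen as a function on all of `ℝ⁵`. -/
lemma exists_threshold (L μ σm σM l : ℝ) : ∃ c₀ : ℝ, ∀ c, 0 < c → c₀ ≤ c → 0 < μ → μ ≤ L →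
    0 < σm → σm ≤ σM → 0 ≤ l → l < 1 → ∃ A cb cX cY cQ,
      Weights L μ σM (L + σM * (σM / μ)) (σm ^ 2 * μ / L ^ 2) l (alphaBar c L μ σm σM l)
        (betaBar L μ σm σM l) A cb cX cY cQ ∧
      alphaBar c L μ σm σM l * (L + σM * (σM / μ)) ^ 2 ≤ σm ^ 2 * μ / L ^ 2 ∧
      alphaBar c L μ σm σM l * (σm ^ 2 * μ / L ^ 2) / 4 ≤ 1 - l := by
  by_cases hp : 0 < μ ∧ μ ≤ L ∧ 0 < σm ∧ σm ≤ σM ∧ 0 ≤ l ∧ l < 1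
  swap
  · exact ⟨0, fun c _ _ h1 h2 h3 h4 h5 h6 => absurd ⟨h1, h2, h3, h4, h5, h6⟩ hp⟩
  obtain ⟨hμ, hμL, hσm, hσ, hl0, hl⟩ := hp
  have hσM : 0 < σM := hσm.trans_le hσ
  have hL : 0 < L := hμ.trans_le hμL
  have hβ := betaBar_pos hL hμ hσm hσM hl
  obtain ⟨A, cb, cX, cY, cQ, hev⟩ := exists_weights hL hμ hσM
    (show 0 < L + σM * (σM / μ) by positivity) (show 0 < σm ^ 2 * μ / L ^ 2 by positivity)
    hl hβ (betaBar_mul_le hL hσm hσ) (betaBar_mul_sq_le hL hμ) hl0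
  obtain ⟨α₀, hα₀, hsub⟩ := mem_nhdsGT_iff_exists_Ioc_subset.mp hev
  refine ⟨betaBar L μ σm σM l * μ ^ 2 / (α₀ * σM ^ 2), fun c hc hcc _ _ _ _ _ _ =>
    ⟨A, cb, cX, cY, cQ, hsub ⟨?_, ?_⟩⟩⟩
  · rw [alphaBar]
    exact mul_pos hβ (by positivity)
  · have hα₀' : 0 < α₀ := hα₀
    rw [div_le_iff₀ (by positivity)] at hcc
    rw [alphaBar, ← mul_div_assoc, div_le_iff₀ (by positivity)]
    linarith

end Rate

end GTGDA

theorem theorem1 :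
    -- `C` is universal; the threshold `c₀` depends only on `L`, `μ`, `σ_m`, `σ_M`, `λ`
    ∃ C : ℝ, 0 < C ∧ ∃ c₀ : ℝ → ℝ → ℝ → ℝ → ℝ → ℝ,
      ∀ (n px py : ℕ) (_ : 0 < n) (_ : 0 < px)
        (D : GTGDA.Problem n px py) (W : Matrix (Fin n) (Fin n) ℝ)
        (L₁ L₂ μ : ℝ) (_ : 0 < L₁) (_ : 0 < L₂) (_ : 0 < μ)
        -- smoothness and convexity
        (_ : ∀ i, GTGDA.IsSmooth L₁ (D.g i)) (_ : ∀ i, GTGDA.IsSmooth L₂ (D.h i))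
        (_ : ConvexOn ℝ Set.univ D.G) (_ : GTGDA.IsStronglyConvex μ D.H)
        -- full column rank
        (_ : D.Pbar.rank = px)
        -- weights
        (_ : W.IsPrimitive) (_ : W ∈ doublyStochastic ℝ (Fin n)) (_ : GTGDA.lam W < 1)
        (L σm σM l c α β R : ℝ) (_ : L = max L₁ L₂) (_ : σm = D.sigmaMin) (_ : σM = D.sigmaMax)
        (_ : l = GTGDA.lam W) (_ : 0 < c) (_ : c₀ L μ σm σM l ≤ c)
        (_ : α = GTGDA.alphaBar c L μ σm σM l) (_ : β = GTGDA.betaBar L μ σm σM l)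
        (_ : R = GTGDA.rate L μ σm σM l),
        ∃ (xs : GTGDA.Vec px) (ys : GTGDA.Vec py),
          -- the unique saddle point
          D.IsSaddle xs ys ∧ (∀ a b, D.IsSaddle a b → a = xs ∧ b = ys) ∧
          -- linear convergence
          (∃ ρ : ℝ, 0 ≤ ρ ∧ ρ < 1 ∧ ρ ≤ 1 - 1 / (C * c * R) ∧
            ∀ x0 y0, ∃ ψ : ℝ, ∀ k : ℕ,
              GTGDA.err (GTGDA.run D W α β x0 y0 k) xs ys ≤ ψ * ρ ^ k) ∧
          -- number of gradient computations at each node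
          (∀ x0 y0, ∃ ε₀ : ℝ, 0 < ε₀ ∧ ∀ ε : ℝ, 0 < ε → ε ≤ ε₀ → ∃ K : ℕ,
            (∀ i, ((GTGDA.run D W α β x0 y0 K).evals i : ℝ) ≤ C * c * R * Real.log (1 / ε)) ∧
            ∀ k, K ≤ k → GTGDA.err (GTGDA.run D W α β x0 y0 k) xs ys ≤ ε) := by
  choose c₀ hc₀ using GTGDA.exists_threshold
  refine ⟨20000, by norm_num, c₀, ?_⟩
  intro n px py hn hpx D W L₁ L₂ μ hL₁ _ hμ hg hh hG hH hr _ hW hlam L σm σM l c α β R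
    hL hσm hσM hl hc hcc hα hβ hR
  have hD : D.WellPosed L μ σm σM := by
    subst hL hσm hσM
    exact GTGDA.Problem.wellPosed hn hpx hL₁ hμ hg hh hG hH hr
  have hσ : σm ≤ σM := by
    rw [hσm, hσM]; exact GTGDA.Problem.sigmaMin_le_sigmaMax
  have hl0 : 0 ≤ l := hl ▸ GTGDA.lam_nonneg W
  have hl1 : l < 1 := hl ▸ hlam
  have hμL : μ ≤ L := hD.μ_le_L hpx
  obtain ⟨A, cb, cX, cY, cQ, w, hαℓ, hθl⟩ :=
    hc₀ L μ σm σM l c hc hcc hμ hμL hD.σm_pos hσ hl0 hl1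
  have hmargin := GTGDA.one_le_rate_mul_margin hμ hD.σm_pos hσ hμL hl0 hl1 hc
  have hβ0 := GTGDA.betaBar_pos hD.L_pos hμ hD.σm_pos hD.σM_pos hl1
  have hβL := GTGDA.betaBar_mul_sq_le (σm := σm) (σM := σM) (l := l) hD.L_pos hμ
  rw [← hβ] at w hβ0 hβL
  rw [← hα] at w hαℓ hθl hmargin
  rw [← hR] at hmargin
  have hα0 : 0 < α := by
    have := hD.σM_pos
    rw [hα, GTGDA.alphaBar, ← hβ]
    positivity
  have hm := hD.modulus_pos
  obtain ⟨θ, hθ⟩ : ∃ θ, θ = α * (σm ^ 2 * μ / L ^ 2) / 4 := ⟨_, rfl⟩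
  have hθ0 : 0 < θ := by rw [hθ]; positivity
  rw [← hθ] at hθl hmargin
  have hcR : 0 < c * R := by
    by_contra hneg
    push Not at hneg
    nlinarith
  have hθ1 : θ ≤ 1 := by linarith
  obtain ⟨xs, hxs⟩ := hD.exists_gradPrimal_eq_zero
  have hconv (x0 : Fin n → GTGDA.Vec px) (y0 : Fin n → GTGDA.Vec py) : ∃ ψ, 0 < ψ ∧ ∀ k,
      GTGDA.err (GTGDA.run D W α β x0 y0 k) xs
        (D.bestResponse (GTGDA.opr D.Pbar xs)) ≤ ψ * (1 - θ / 2) ^ k := by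
    subst hl
    rw [hθ]
    exact GTGDA.exists_err_run_le hD hW hlam hα0 hβ0.le w hαℓ
      (by nlinarith [mul_pos hβ0 (pow_pos hD.L_pos 2)]) (hθ ▸ hθl) hxs x0 y0
  refine ⟨xs, D.bestResponse (GTGDA.opr D.Pbar xs), (hD.isSaddle_iff _ _).mpr ⟨hxs, rfl⟩,
    fun a b hab => ?_, ⟨1 - θ / 2, by linarith, by linarith, ?_, fun x0 y0 => ?_⟩,
    fun x0 y0 => ?_⟩
  · obtain ⟨h1, h2⟩ := (hD.isSaddle_iff _ _).mp hab
    have h3 : a = xs :=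
      GTGDA.eq_of_stronglyMonotone hm hD.inner_gradPrimal_ge (h1.trans hxs.symm)
    exact ⟨h3, h3 ▸ h2⟩
  · have : 1 / (20000 * c * R) ≤ θ / 2 := by
      rw [mul_assoc, div_le_iff₀ (by positivity)]
      nlinarith
    linarith
  · obtain ⟨ψ, -, hψ⟩ := hconv x0 y0
    exact ⟨ψ, hψ⟩
  · obtain ⟨ψ, hψ0, hψ⟩ := hconv x0 y0
    obtain ⟨ε₀, hε₀, hbound⟩ := GTGDA.exists_iteration_bound hψ0 hθ0 hθ1 hψ
    -- for `ε ≤ 1` the logarithm is nonnegative, so that `12 / θ` may be replaced by its bound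
    refine ⟨min ε₀ 1, by positivity, fun ε hε hle => ?_⟩
    obtain ⟨K, hK, hKe⟩ := hbound ε hε (hle.trans (min_le_left _ _))
    refine ⟨K, fun i => ?_, hKe⟩
    rw [GTGDA.run_evals]
    push_cast
    refine hK.trans (mul_le_mul_of_nonneg_right ?_ (Real.log_nonneg ?_))
    · rw [div_le_iff₀ hθ0]
      nlinarith
    · rw [le_div_iff₀ hε, one_mul]
      exact hle.trans (min_le_right _ _)
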